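/- A composition is a sequence $\alpha=(\alpha_1,\alpha_2,\dots)$ of nonnegative integers, almost all $0$; $\alpha^+$ denotes its weakly decreasing rearrangement. Let $R=\mathbb{Z}[\beta][x_1,x_2,\dots]$, let $s_i$ exchange $x_i$ and $x_{i+1}$ (and, on compositions, $\alpha_i$ and $\alpha_{i+1}$), and put $\pi^{(\beta)}_i(f)=\dfrac{g-s_i(g)}{x_i-x_{i+1}}$ with $g=(1+\beta x_{i+1})x_i f$. The Lascoux polynomials $\mathfrak{L}^{(\beta)}_\alpha\in R$ are defined by $\mathfrak{L}^{(\beta)}_\alpha=x^\alpha$ if $\alpha$ is a partition, and $\mathfrak{L}^{(\beta)}_\alpha=\pi^{(\beta)}_i\mathfrak{L}^{(\beta)}_{s_i\alpha}$ if $\alpha_i<\alpha_{i+1}$. A reverse semistandard tableau (RSSYT) of partition shape $\lambda$ is a filling $T$ of the boxes of $\lambda$ by positive integers that weakly decreases along rows (left to right) and strictly decreases down columns; $\mathrm{wt}(T)_i$ is the number of entries $i$. For finite sets $C$ and $D=\{a_1<\dots<a_m\}$ of positive integers such that $C,D$ (in this order) are the two columns of an RSSYT, let $C\triangleleft D=\{b_1<\dots<b_m\}$,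 where $b_j$ is the smallest element of $C$ with $b_j\ge a_j$ and (if $j>1$) $b_j>b_{j-1}$. If $T$ has columns $C_1,C_2,\dots$, regarded as sets, put $D_k=C_1\triangleleft(C_2\triangleleft(\cdots\triangleleft C_k))$; the left key $K_-(T)$ is the composition whose $i$-th part is the number of $k$ with $i\in D_k$. On compositions let $\le$ be the Bruhat order on orbits: the reflexive transitive closure of the relations $\gamma<t\gamma$, where $t$ exchanges the parts in positions $a<b$ and $\gamma_a>\gamma_b$. **Theorem.** For every composition $\alpha$ there are only finitely many RSSYT $T$ of shape $\alpha^+$ with $K_-(T)\le\alpha$, and $$\mathfrak{L}^{(\beta)}_\alpha=\sum_{\substack{T\in\mathrm{RSSYT}_{\alpha^+}\\ K_-(T)\le\alpha}}x^{\mathrm{wt}(T)}\prod_{(s,k)}(1+\beta x_k),$$ where the product runs over the pairs $(s,k)$ of a box $s$ of $\alpha^+$ and a positive integer $k<T(s)$ such that replacing the entry of $T$ in box $s$ by $k$ gives an RSSYT. -/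

import Mathlib

open MvPolynomial

/-! Conventions. All index sets `ℤ_{>0} = {1, 2, 3, …}` are relabelled as `ℕ = {0, 1, 2, …}` by the
order isomorphism `i ↦ i - 1`.  This applies to the variables, to the parts of compositions, to the
entries of tableaux, and to the rows and columns of diagrams.  Only the order and the successor
function on these index sets are ever used. -/

/-- Compositions: sequences of nonnegative integers, almost all zero. -/
abbrev Comp := ℕ →₀ ℕ

/-- The polynomial ring `ℤ[β][x₀, x₁, …]`. -/
abbrev LRing := MvPolynomial ℕ (Polynomial ℤ)

noncomputable section

/-- The parameter `β`, as an element of `ℤ[β][x₀, x₁, …]`. -/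
def betaVar : LRing := C Polynomial.X

/-- The monomial `x^α`. -/
def xpow (α : Comp) : LRing := monomial α 1

/-- The action of the simple transposition `s_i` on polynomials, exchanging `x_i` and `x_{i+1}`. -/
def sPoly (i : ℕ) : LRing →ₐ[Polynomial ℤ] LRing := rename (Equiv.swap i (i + 1))

/-- The permutation action on compositions exchanging the parts in positions `i` and `j`. -/
def swapComp (i j : ℕ) (α : Comp) : Comp := α.equivMapDomain (Equiv.swap i j)

theorem sub_sPoly_dvd (i : ℕ) (f : LRing) :
    (X i - X (i + 1) : LRing) ∣ f - sPoly i f := by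
  induction f using MvPolynomial.induction_on with
  | C a => simp [sPoly]
  | add p q hp hq =>
    have h := dvd_add hp hq
    rw [map_add]
    convert h using 1
    ring
  | mul_X p n hp =>
    have hX : (X i - X (i + 1) : LRing) ∣ X n - sPoly i (X n) := by
      simp only [sPoly, rename_X]
      rcases eq_or_ne n i with rfl | h1
      · simp
      · rcases eq_or_ne n (i + 1) with rfl | h2
        · rw [Equiv.swap_apply_right]
          exact ⟨-1, by ring⟩
        · rw [Equiv.swap_apply_of_ne_of_ne h1 h2]
          simp
    have h := dvd_add (hp.mul_right (X n)) (hX.mul_left (sPoly i p))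
    rw [map_mul]
    convert h using 1
    ring

/-- The divided difference `∂_i f = (x_i - x_{i+1})⁻¹ (f - s_i f)`, i.e. the exact quotient. -/
def ddiff (i : ℕ) (f : LRing) : LRing := Classical.choose (sub_sPoly_dvd i f)

theorem ddiff_spec (i : ℕ) (f : LRing) :
    (X i - X (i + 1)) * ddiff i f = f - sPoly i f :=
  (Classical.choose_spec (sub_sPoly_dvd i f)).symm

/-- `∂^{(β)}_i = ∂_i (1 + β x_{i+1})`. -/
def ddiffBeta (i : ℕ) (f : LRing) : LRing := ddiff i ((1 + betaVar * X (i + 1)) * f)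

/-- `π^{(β)}_i = ∂^{(β)}_i x_i`. -/
def piBeta (i : ℕ) (f : LRing) : LRing := ddiffBeta i (X i * f)

theorem swapComp_apply (i j k : ℕ) (α : Comp) :
    swapComp i j α k = α (Equiv.swap i j k) := by
  simp [swapComp, Finsupp.equivMapDomain_apply]

/-- The measure `∑ i · α_i` that makes the recursion for Lascoux polynomials terminate. -/
def momentum (α : Comp) : ℕ := α.sum fun i a => i * a

theorem momentum_swapComp_lt (i : ℕ) (α : Comp) (h : α i < α (i + 1)) :
    momentum (swapComp i (i + 1) α) < momentum α := by
  have key : ∀ γ : Comp, momentum γ =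
      momentum ((γ.erase i).erase (i + 1)) + i * γ i + (i + 1) * γ (i + 1) := by
    intro γ
    have e1 := Finsupp.add_sum_erase' γ i (fun i a => i * a) (by simp)
    have e2 := Finsupp.add_sum_erase' (γ.erase i) (i + 1) (fun i a => i * a) (by simp)
    rw [Finsupp.erase_ne (by omega)] at e2
    simp only [momentum]
    omega
  have he : ((swapComp i (i + 1) α).erase i).erase (i + 1) = (α.erase i).erase (i + 1) := by
    ext k
    by_cases h2 : k = i + 1
    · simp [h2]
    · by_cases h1 : k = i
      · simp [h1]
      · simp [Finsupp.erase_ne, h1, h2, swapComp_apply, Equiv.swap_apply_of_ne_of_ne h1 h2]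
  rw [key α, key (swapComp i (i + 1) α), he]
  simp only [swapComp_apply, Equiv.swap_apply_left, Equiv.swap_apply_right]
  nlinarith

open Classical in
/-- The Lascoux polynomial: `x^α` if `α` is a partition (has no ascent), and otherwise
`π^{(β)}_i` applied to the Lascoux polynomial of `s_i α`, for the first ascent `α_i < α_{i+1}`.
By `lascoux_of_ascent` below every other ascent gives the same polynomial. -/
def lascoux (α : Comp) : LRing :=
  if h : ∃ i, α i < α (i + 1) then
    piBeta (Nat.find h) (lascoux (swapComp (Nat.find h) (Nat.find h + 1) α))
  else xpow α
termination_by momentum α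
decreasing_by exact momentum_swapComp_lt _ _ (Nat.find_spec h)

theorem lascoux_of_partition (α : Comp) (h : Antitone α) : lascoux α = xpow α := by
  rw [lascoux, dif_neg]
  rintro ⟨i, hi⟩
  exact absurd (h (Nat.le_succ i)) (by simpa using hi)

theorem piBeta_spec (i : ℕ) (f : LRing) :
    (X i - X (i + 1)) * piBeta i f =
      X i * (1 + betaVar * X (i + 1)) * f - X (i + 1) * (1 + betaVar * X i) * sPoly i f := by
  rw [piBeta, ddiffBeta, ddiff_spec]
  simp only [sPoly, betaVar, map_mul, map_add, map_one, rename_X, rename_C,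
    Equiv.swap_apply_left, Equiv.swap_apply_right]
  ring

theorem X_sub_X_ne {i j : ℕ} (h : i ≠ j) : (X i - X j : LRing) ≠ 0 :=
  sub_ne_zero.2 fun e => h (X_injective e)

theorem sPoly_X_self (i : ℕ) : sPoly i (X i) = X (i + 1) := by simp [sPoly]

theorem sPoly_X_succ (i : ℕ) : sPoly i (X (i + 1)) = X i := by simp [sPoly]

theorem sPoly_X_of_ne {i k : ℕ} (h1 : k ≠ i) (h2 : k ≠ i + 1) : sPoly i (X k) = X k := by
  simp [sPoly, Equiv.swap_apply_of_ne_of_ne h1 h2]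

theorem sPoly_beta (i : ℕ) : sPoly i betaVar = betaVar := by simp [sPoly, betaVar]

theorem sPoly_sPoly (i : ℕ) (f : LRing) : sPoly i (sPoly i f) = f := by
  simp only [sPoly, rename_rename]
  have : (⇑(Equiv.swap i (i + 1)) ∘ ⇑(Equiv.swap i (i + 1))) = id := by ext; simp
  rw [this, rename_id_apply]

theorem sPoly_comm {i j : ℕ} (h : i + 2 ≤ j) (f : LRing) :
    sPoly i (sPoly j f) = sPoly j (sPoly i f) := by
  simp only [sPoly, rename_rename]
  congr 2
  ext k
  simp only [Function.comp_apply, Equiv.swap_apply_def]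
  split_ifs <;> omega

theorem sPoly_braid (i : ℕ) (f : LRing) :
    sPoly i (sPoly (i + 1) (sPoly i f)) = sPoly (i + 1) (sPoly i (sPoly (i + 1) f)) := by
  simp only [sPoly, rename_rename]
  congr 2
  ext k
  simp only [Function.comp_apply, Equiv.swap_apply_def]
  split_ifs <;> omega

theorem piBeta_comm {i j : ℕ} (h : i + 2 ≤ j) (f : LRing) :
    piBeta i (piBeta j f) = piBeta j (piBeta i f) := by
  apply mul_left_cancel₀ (mul_ne_zero (X_sub_X_ne (show i ≠ i + 1 by omega))
    (X_sub_X_ne (show j ≠ j + 1 by omega)))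
  have e1 := piBeta_spec i (piBeta j f)
  have e2 := piBeta_spec j (piBeta i f)
  have e3 := piBeta_spec j f
  have e4 := piBeta_spec i f
  have e5 := congrArg (sPoly i) e3
  have e6 := congrArg (sPoly j) e4
  have a1 := sPoly_X_of_ne (i := i) (k := j) (by omega) (by omega)
  have a2 := sPoly_X_of_ne (i := i) (k := j + 1) (by omega) (by omega)
  have a3 := sPoly_X_of_ne (i := j) (k := i) (by omega) (by omega)
  have a4 := sPoly_X_of_ne (i := j) (k := i + 1) (by omega) (by omega)
  simp only [map_mul, map_sub, map_add, map_one, sPoly_beta, a1, a2] at e5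
  simp only [map_mul, map_sub, map_add, map_one, sPoly_beta, a3, a4] at e6
  rw [sPoly_comm h] at e5
  linear_combination (X j - X (j + 1)) * e1 - (X i - X (i + 1)) * e2
    + X i * (1 + betaVar * X (i + 1)) * e3 - X (i + 1) * (1 + betaVar * X i) * e5
    - X j * (1 + betaVar * X (j + 1)) * e4 + X (j + 1) * (1 + betaVar * X j) * e6

theorem piBeta_braid (i : ℕ) (f : LRing) :
    piBeta i (piBeta (i + 1) (piBeta i f)) = piBeta (i + 1) (piBeta i (piBeta (i + 1) f)) := by
  have n1 := X_sub_X_ne (show i ≠ i + 1 by omega)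
  have n2 := X_sub_X_ne (show i + 1 ≠ i + 1 + 1 by omega)
  have n3 := X_sub_X_ne (show i ≠ i + 1 + 1 by omega)
  apply mul_left_cancel₀ (mul_ne_zero (mul_ne_zero (mul_ne_zero n1 n1) (mul_ne_zero n2 n2)) n3)
  have e1 := piBeta_spec i f
  have e2 := piBeta_spec (i + 1) (piBeta i f)
  have e3 := piBeta_spec i (piBeta (i + 1) (piBeta i f))
  have e4 := congrArg (sPoly (i + 1)) e1
  have e5 := congrArg (sPoly i) e2
  have e6 := congrArg (sPoly i) e1
  have e7 := congrArg (sPoly i) e4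
  have f1 := piBeta_spec (i + 1) f
  have f2 := piBeta_spec i (piBeta (i + 1) f)
  have f3 := piBeta_spec (i + 1) (piBeta i (piBeta (i + 1) f))
  have f4 := congrArg (sPoly i) f1
  have f5 := congrArg (sPoly (i + 1)) f2
  have f6 := congrArg (sPoly (i + 1)) f1
  have f7 := congrArg (sPoly (i + 1)) f4
  have a1 := sPoly_X_of_ne (i := i) (k := i + 1 + 1) (by omega) (by omega)
  have a2 := sPoly_X_of_ne (i := i + 1) (k := i) (by omega) (by omega)
  simp only [map_mul, map_sub, map_add, map_one, sPoly_beta, a1, a2, sPoly_X_self, sPoly_X_succ,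
    sPoly_sPoly] at e4 e5 e6 e7 f4 f5 f6 f7
  rw [sPoly_braid] at e7
  generalize (X i : LRing) = x at *
  generalize (X (i + 1) : LRing) = y at *
  generalize (X (i + 1 + 1) : LRing) = z at *
  generalize betaVar = b at *
  linear_combination
    (y - z) * ((x - y) * (y - z) * (x - z) * e3
      + x * (1 + b * y) * (x - y) * (x - z) * e2
      - y * (1 + b * x) * (x - y) * (y - z) * e5
      + x * (1 + b * y) * (y * (1 + b * z)) * (x - z) * e1
      - x * (1 + b * y) * (z * (1 + b * y)) * (x - y) * e4
      + y * (1 + b * x) * (x * (1 + b * z)) * (y - z) * e6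
      + y * (1 + b * x) * (z * (1 + b * x)) * (x - y) * e7)
    - (x - y) * ((y - z) * (x - y) * (x - z) * f3
      + y * (1 + b * z) * (y - z) * (x - z) * f2
      - z * (1 + b * y) * (y - z) * (x - y) * f5
      + y * (1 + b * z) * (x * (1 + b * y)) * (x - z) * f1
      - y * (1 + b * z) * (y * (1 + b * x)) * (y - z) * f4
      + z * (1 + b * y) * (x * (1 + b * z)) * (x - y) * f6
      + z * (1 + b * y) * (z * (1 + b * x)) * (y - z) * f7)

theorem swapComp_comm {i j : ℕ} (h : i + 2 ≤ j) (α : Comp) :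
    swapComp i (i + 1) (swapComp j (j + 1) α) = swapComp j (j + 1) (swapComp i (i + 1) α) := by
  ext k
  simp only [swapComp_apply]
  congr 1
  simp only [Equiv.swap_apply_def]
  split_ifs <;> omega

theorem swapComp_braid (i : ℕ) (α : Comp) :
    swapComp i (i + 1) (swapComp (i + 1) (i + 1 + 1) (swapComp i (i + 1) α)) =
      swapComp (i + 1) (i + 1 + 1) (swapComp i (i + 1) (swapComp (i + 1) (i + 1 + 1) α)) := by
  ext k
  simp only [swapComp_apply]
  congr 1
  simp only [Equiv.swap_apply_def]
  split_ifs <;> omega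

/-- The defining recursion of Lascoux polynomials holds at every ascent. -/
theorem lascoux_of_ascent (α : Comp) (i : ℕ) (h : α i < α (i + 1)) :
    lascoux α = piBeta i (lascoux (swapComp i (i + 1) α)) := by
  classical
  induction hn : momentum α using Nat.strong_induction_on generalizing α i with
  | _ n ih =>
  subst hn
  have hex : ∃ i, α i < α (i + 1) := ⟨i, h⟩
  have hj := Nat.find_spec hex
  have hji : Nat.find hex ≤ i := Nat.find_min' hex h
  have hL : lascoux α = piBeta (Nat.find hex)
      (lascoux (swapComp (Nat.find hex) (Nat.find hex + 1) α)) := by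
    conv_lhs => rw [lascoux, dif_pos hex]
  generalize Nat.find hex = j at hj hji hL
  have key := momentum_swapComp_lt
  rw [hL]
  rcases Nat.eq_or_lt_of_le hji with rfl | hlt
  · rfl
  rcases Nat.eq_or_lt_of_le (Nat.succ_le_of_lt hlt) with rfl | hlt2
  · -- adjacent ascents
    simp only [Nat.succ_eq_add_one] at *
    have v : ∀ β : Comp, swapComp j (j + 1) β j = β (j + 1) ∧
        swapComp j (j + 1) β (j + 1) = β j ∧
        swapComp j (j + 1) β (j + 1 + 1) = β (j + 1 + 1) := fun β => by
      simp only [swapComp_apply, Equiv.swap_apply_left, Equiv.swap_apply_right, true_and]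
      rw [Equiv.swap_apply_of_ne_of_ne] <;> omega
    have w : ∀ β : Comp, swapComp (j + 1) (j + 1 + 1) β (j + 1) = β (j + 1 + 1) ∧
        swapComp (j + 1) (j + 1 + 1) β (j + 1 + 1) = β (j + 1) ∧
        swapComp (j + 1) (j + 1 + 1) β j = β j := fun β => by
      simp only [swapComp_apply, Equiv.swap_apply_left, Equiv.swap_apply_right, true_and]
      rw [Equiv.swap_apply_of_ne_of_ne] <;> omega
    have m1 := key j α hj
    have m2 := key (j + 1) α h
    have p1 : swapComp j (j + 1) α (j + 1) < swapComp j (j + 1) α (j + 1 + 1) := by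
      rw [(v α).2.1, (v α).2.2]; omega
    have p2 : swapComp (j + 1) (j + 1 + 1) α j < swapComp (j + 1) (j + 1 + 1) α (j + 1) := by
      rw [(w α).1, (w α).2.2]; omega
    have m3 := key _ _ p1
    have m4 := key _ _ p2
    rw [ih _ m1 _ (j + 1) p1 rfl, ih _ m2 _ j p2 rfl]
    rw [ih _ (m3.trans m1) _ j (by
      rw [(w _).2.2, (w _).1, (v _).1, (v _).2.2]; omega) rfl]
    rw [ih _ (m4.trans m2) _ (j + 1) (by
      rw [(v _).2.1, (v _).2.2, (w _).2.2, (w _).2.1]; omega) rfl]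
    rw [piBeta_braid, swapComp_braid]
  · -- distant ascents
    have hd : j + 2 ≤ i := hlt2
    have p1 : swapComp j (j + 1) α i < swapComp j (j + 1) α (i + 1) := by
      simp only [swapComp_apply]
      rwa [Equiv.swap_apply_of_ne_of_ne, Equiv.swap_apply_of_ne_of_ne] <;> omega
    have p2 : swapComp i (i + 1) α j < swapComp i (i + 1) α (j + 1) := by
      simp only [swapComp_apply]
      rwa [Equiv.swap_apply_of_ne_of_ne, Equiv.swap_apply_of_ne_of_ne] <;> omega
    rw [ih _ (key _ _ hj) _ i p1 rfl, ih _ (key _ _ h) _ j p2 rfl, piBeta_comm hd,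
      swapComp_comm hd]

/-- The partition `α⁺`: the Young diagram whose row lengths are the nonzero parts of `α` in
weakly decreasing order.  The box in row `r` and column `c` is `(r, c)`. -/
def shape (α : Comp) : YoungDiagram :=
  YoungDiagram.ofRowLens ((α.support.val.map α).sort (· ≥ ·))
    (Multiset.pairwise_sort _ _).sortedGE

/-- `T` is a reverse semistandard tableau of shape `μ`: entries weakly decrease along rows from left
to right and strictly decrease along columns from top to bottom.  A tableau is stored as a function
on all pairs (row, column); outside the boxes of `μ` it is given the fixed value `0`, so that
tableaux of shape `μ` are the same as such functions. -/
structure IsRSSYT (μ : YoungDiagram) (T : ℕ × ℕ → ℕ) : Prop where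
  row_weak : ∀ r c₁ c₂, c₁ < c₂ → (r, c₂) ∈ μ → T (r, c₂) ≤ T (r, c₁)
  col_strict : ∀ r₁ r₂ c, r₁ < r₂ → (r₂, c) ∈ μ → T (r₂, c) < T (r₁, c)
  zeros : ∀ s, s ∉ μ → T s = 0

/-- The weight of a tableau: `(wt T)_i` is the number of boxes with entry `i`. -/
def wt (μ : YoungDiagram) (T : ℕ × ℕ → ℕ) : Comp := ∑ s ∈ μ.cells, Finsupp.single (T s) 1

/-- The greedy choice in the definition of `C ◁ D`: for `a₁ < a₂ < ⋯` listed increasingly, pick the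
smallest `b₁ ∈ C` with `b₁ ≥ a₁`, then the smallest `b₂ ∈ C` with `b₂ ≥ a₂` and `b₂ > b₁`, and so
on.  (If some choice is impossible the procedure stops; this does not happen when `C`, `D`
are the two columns of a reverse semistandard tableau.) -/
def greedyPick : Finset ℕ → List ℕ → List ℕ
  | _, [] => []
  | C, a :: l =>
    if h : (C.filter fun b => a ≤ b).Nonempty then
      (C.filter fun b => a ≤ b).min' h ::
        greedyPick (C.filter fun b => (C.filter fun b => a ≤ b).min' h < b) l
    else []

/-- `C ◁ D`. -/
def tri (C D : Finset ℕ) : Finset ℕ := (greedyPick C (D.sort (· ≤ ·))).toFinset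

/-- The set of entries in column `c` of `T`. -/
def column (μ : YoungDiagram) (T : ℕ × ℕ → ℕ) (c : ℕ) : Finset ℕ :=
  (Finset.range (μ.colLen c)).image fun r => T (r, c)

/-- Column `c` of the left key tableau: `C₀ ◁ (C₁ ◁ (⋯ ◁ (C_{c-1} ◁ C_c)))`, where `C_j` is
column `j` of `T`. -/
def leftKeyColumn (μ : YoungDiagram) (T : ℕ × ℕ → ℕ) (c : ℕ) : Finset ℕ :=
  (List.range c).foldr (fun j D => tri (column μ T j) D) (column μ T c)

/-- The left key `K_-(T)`, as a composition: its `i`-th part is the number of columns of the left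
key tableau that contain `i`. -/
def leftKey (μ : YoungDiagram) (T : ℕ × ℕ → ℕ) : Comp :=
  ∑ c ∈ Finset.range (μ.rowLen 0), ∑ i ∈ leftKeyColumn μ T c, Finsupp.single i 1

/-- The Bruhat order on the orbits of compositions (the quotient of Bruhat order with the partition
`α⁺` as the minimum of its orbit): the reflexive transitive closure of the relations
`γ < t γ`, where `t` exchanges positions `a < b` with `γ_a > γ_b`. -/
def BruhatLE : Comp → Comp → Prop :=
  Relation.ReflTransGen fun γ δ => ∃ a b, a < b ∧ γ b < γ a ∧ δ = swapComp a b γ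

/-- The reverse semistandard tableaux `T` of shape `α⁺` with `K_-(T) ≤ α`. -/
def tableauxBelow (α : Comp) : Set (ℕ × ℕ → ℕ) :=
  {T | IsRSSYT (shape α) T ∧ BruhatLE (leftKey (shape α) T) α}

open Classical in
/-- `∏_{(s,k)} (1 + β x_k)` over all pairs of a box `s` of `μ` and a value `k < T(s)` such that
replacing the entry of `T` in `s` by `k` gives a reverse semistandard tableau. -/
def replaceProd (μ : YoungDiagram) (T : ℕ × ℕ → ℕ) : LRing :=
  ∏ s ∈ μ.cells, ∏ k ∈ (Finset.range (T s)).filter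
    (fun k => IsRSSYT μ (Function.update T s k)), (1 + betaVar * X k)

end

/-! Both sides obey the same recursion: if α_i < α_{i+1}, then π_i turns the tableau sum over keys ≤
s_iα into the one over keys ≤ α. Since π_i does not act on single tableaux, the whole key is
remembered. The sum of weight(T)·[K_-(T)] over all tableaux of one shape with entries below N is a
combination of elements g[κ] + (π_i − 1)(g)[s_iκ], where every column of κ containing i+1 contains i
(`atomSums`, `sum_colSum_mem`).

Given this form, the recursion is a property of Bruhat order. For such κ the conditions κ ≤ α, s_iκ
≤ α and κ ≤ s_iα are equivalent. Hence an element contributes 0 or π_i g below α, and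
correspondingly 0, or one of g and π_i g, below s_iα; idempotence of π_i concludes
(`piBeta_evalBelow`). For a partition a single tableau survives (`belowSum_of_antitone`).

The form is proved by adding columns on the left. Putting C before a tableau with first column C'
multiplies the weight by a factor depending only on C and C' (`colCoeff`) and sends the key columns
D to C ◁ D, with C in front (`keyCons`). The induction (`colSum_mem`) carries a statement in three
cases. If C contains neither i nor i+1, coefficients are symmetric and keys avoid i and i+1
(`symmSums`). If C contains both, the sum is in `atomSums`. If C contains only i, the sums for C and
s_iC jointly are made of pairs (g[κ], (π_i − 1)(g)[s_iκ]) (`atomPairs`). The step needs the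
behaviour of ◁ under s_i, read off from a scan that counts waiting elements (`mem_tri`), and the
local factors in x_i and x_{i+1}, which fit identities for π_i − 1. -/

noncomputable section

/-! ### Greedy matching as a scan from small to large. -/

/-- The number of elements of `D` below `t` that are still unmatched when the greedy matching of
`D` into `C` has scanned all positions below `t`. -/
def pending (C D : Finset ℕ) : ℕ → ℕ
  | 0 => 0
  | t + 1 => pending C D t + (if t ∈ D then 1 else 0) - (if t ∈ C then 1 else 0)

theorem pending_congr {C C' D D' : Finset ℕ} {n t : ℕ} (hnt : n ≤ t)
    (h0 : pending C D n = pending C' D' n)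
    (h : ∀ s, n ≤ s → s < t → (s ∈ C ↔ s ∈ C') ∧ (s ∈ D ↔ s ∈ D')) :
    pending C D t = pending C' D' t := by
  induction t, hnt using Nat.le_induction with
  | base => exact h0
  | succ t hnt ih =>
    have := h t hnt (Nat.lt_succ_self t)
    simp only [pending, ih fun s h1 h2 => h s h1 (h2.trans (Nat.lt_succ_self t)), this.1, this.2]

theorem pending_eq_zero {C D : Finset ℕ} {t : ℕ} (h : ∀ s ∈ D, t ≤ s) : pending C D t = 0 := by
  induction t with
  | zero => rfl
  | succ t ih =>
    have ht : t ∉ D := fun hm => absurd (h t hm) (by omega)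
    simp [pending, ih fun s hs => (Nat.le_succ t).trans (h s hs), ht]

theorem pending_mono {C D D' : Finset ℕ} (h : D ⊆ D') (t : ℕ) :
    pending C D t ≤ pending C D' t := by
  induction t with
  | zero => rfl
  | succ t ih =>
    simp only [pending]
    have : t ∈ D → t ∈ D' := fun hm => h hm
    split_ifs <;> first | omega | tauto

/-- The set of chosen elements depends only on how many elements wait at each position, not on who
is matched with whom. Truncated subtraction in `pending` records that an element of C with nothing
to serve stays unused. -/
theorem mem_greedyPick (l : List ℕ) (hl : l.Pairwise (· < ·)) (C : Finset ℕ) (t : ℕ) :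
    t ∈ greedyPick C l ↔
      t ∈ C ∧ 0 < pending C l.toFinset t + (if t ∈ l then 1 else 0) := by
  induction l generalizing C with
  | nil =>
    simp [greedyPick, pending_eq_zero]
  | cons a l ih =>
    obtain ⟨hal, hl⟩ := List.pairwise_cons.1 hl
    rw [greedyPick]
    by_cases hne : (C.filter fun b => a ≤ b).Nonempty
    · rw [dif_pos hne]
      have hb := Finset.min'_mem _ hne
      have hmin : ∀ c ∈ C, a ≤ c → (C.filter fun b => a ≤ b).min' hne ≤ c := fun c hc hac =>
        Finset.min'_le _ _ (Finset.mem_filter.2 ⟨hc, hac⟩)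
      generalize (C.filter fun b => a ≤ b).min' hne = b at hb hmin ⊢
      obtain ⟨hbC, hab⟩ := Finset.mem_filter.1 hb
      -- Removing a together with its partner b lowers the count by one exactly on (a, b]: no
      -- element of C lies in [a, b), and b serves a.
      have key : ∀ t, pending C (a :: l).toFinset t =
          pending (C.filter (b < ·)) l.toFinset t + if a < t ∧ t ≤ b then 1 else 0 := by
        intro t
        induction t with
        | zero => simp [pending]
        | succ t iht =>
          simp only [pending, iht, List.mem_toFinset, List.mem_cons, Finset.mem_filter]
          rcases lt_or_ge t a with hta | hta
          · have h0 : pending (C.filter (b < ·)) l.toFinset t = 0 :=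
              pending_eq_zero fun s hs => (hta.trans (hal s (List.mem_toFinset.1 hs))).le
            have h1 : t ∉ l := fun hm => absurd (hal t hm) (by omega)
            have h2 : ¬ b < t := by omega
            have h3 : ¬ a < t := by omega
            have h4 : ¬ a < t + 1 := by omega
            simp [h0, h1, h2, h3, h4, hta.ne]
          · rcases lt_trichotomy t b with htb | rfl | htb
            · have h1 : t ∉ C := fun hm => absurd (hmin t hm hta) (by omega)
              have h2 : a < t + 1 ∧ t + 1 ≤ b := by omega
              simp only [h1, false_and, if_false, h2, and_self, if_true]
              rcases hta.eq_or_lt with rfl | hta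
              · have h3 : a ∉ l := fun hm => absurd (hal a hm) (by omega)
                simp [h3]
              · have h3 : t ≠ a := by omega
                simp only [h3, false_or, hta, htb.le, and_self, if_true]
                omega
            · have h2 : ¬ (a < t + 1 ∧ t + 1 ≤ t) := by omega
              simp only [hbC, lt_irrefl, and_false, if_false, if_true, h2]
              rcases hta.eq_or_lt with rfl | hta
              · have h3 : a ∉ l := fun hm => absurd (hal a hm) (by omega)
                simp [h3]
              · have h3 : t ≠ a := by omega
                simp only [h3, false_or, hta, le_refl, and_self, if_true]
                omega
            · have h4 : t ≠ a := by omega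
              have h5 : ¬ t + 1 ≤ b := by omega
              have h6 : ¬ t ≤ b := by omega
              simp [h4, h5, h6, htb]
      simp only [List.mem_cons, ih hl, key, Finset.mem_filter]
      rcases lt_trichotomy t b with htb | rfl | htb
      · have h2 : ¬ b < t := by omega
        simp only [htb.ne, h2, and_false, false_and, or_false, false_iff, not_and, not_lt]
        intro htC
        have hta : t < a := lt_of_not_ge fun h => absurd (hmin t htC h) (by omega)
        have h1 : t ∉ l := fun hm => absurd (hal t hm) (by omega)
        have h3 : ¬ a < t := by omega
        rw [pending_eq_zero fun s hs => (hta.trans (hal s (List.mem_toFinset.1 hs))).le]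
        simp [h1, h3, hta.ne]
      · simp only [true_or, hbC, true_and, true_iff, le_refl, and_true]
        rcases hab.eq_or_lt with rfl | h
        · simp
        · simp [h]
      · have h3 : ¬ (a < t ∧ t ≤ b) := by omega
        have h4 : t ≠ a := by omega
        simp [h3, h4, htb, htb.ne']
    -- Here every element of C lies below a, where nothing is waiting, so stopping agrees with the
    -- scan.
    · rw [dif_neg hne]
      simp only [List.not_mem_nil, false_iff, not_and, not_lt]
      intro htC
      have hta : t < a := lt_of_not_ge fun h => hne ⟨t, Finset.mem_filter.2 ⟨htC, h⟩⟩
      have h1 : t ∉ l := fun hm => absurd (hal t hm) (by omega)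
      rw [pending_eq_zero]
      · simp [h1, hta.ne]
      · intro s hs
        rcases List.mem_cons.1 (List.mem_toFinset.1 hs) with rfl | hs
        · exact hta.le
        · exact (hta.trans (hal s hs)).le

theorem mem_tri {C D : Finset ℕ} {t : ℕ} :
    t ∈ tri C D ↔ t ∈ C ∧ 0 < pending C D t + (if t ∈ D then 1 else 0) := by
  rw [tri, List.mem_toFinset, mem_greedyPick _ (Finset.sortedLT_sort D).pairwise]
  simp

theorem tri_subset (C D : Finset ℕ) : tri C D ⊆ C := fun _ h => (mem_tri.1 h).1

theorem tri_mono (C : Finset ℕ) {D D' : Finset ℕ} (h : D ⊆ D') : tri C D ⊆ tri C D' := by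
  intro t ht
  rw [mem_tri] at ht ⊢
  refine ⟨ht.1, ht.2.trans_le ?_⟩
  have := pending_mono (C := C) h t
  have : t ∈ D → t ∈ D' := fun hm => h hm
  split_ifs <;> first | omega | tauto

/-- Every element is matched with itself on arrival, so the count stays zero. -/
theorem tri_range {n : ℕ} {D : Finset ℕ} (h : D ⊆ Finset.range n) :
    tri (Finset.range n) D = D := by
  have h0 : ∀ t, t ≤ n → pending (Finset.range n) D t = 0 := by
    intro t
    induction t with
    | zero => intro; rfl
    | succ t ih =>
      intro ht
      have : t < n := ht
      simp only [pending, ih this.le, Finset.mem_range, this, if_true]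
      split_ifs <;> rfl
  ext t
  rw [mem_tri, Finset.mem_range]
  constructor
  · rintro ⟨h1, h2⟩
    rw [h0 t h1.le] at h2
    by_contra h3
    simp [h3] at h2
  · intro h1
    exact ⟨Finset.mem_range.1 (h h1), by simp [h1]⟩

/-! ### The operation ◁ under a simple transposition. -/

/-- The action of the simple transposition `s_i` on sets of integers. -/
def swapSet (i : ℕ) (D : Finset ℕ) : Finset ℕ := D.map (Equiv.swap i (i + 1)).toEmbedding

theorem mem_swapSet {i t : ℕ} {D : Finset ℕ} :
    t ∈ swapSet i D ↔ Equiv.swap i (i + 1) t ∈ D := by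
  rw [swapSet, Finset.mem_map_equiv, Equiv.symm_swap]

@[simp] theorem left_mem_swapSet {i : ℕ} {D : Finset ℕ} : i ∈ swapSet i D ↔ i + 1 ∈ D := by
  rw [mem_swapSet, Equiv.swap_apply_left]

@[simp] theorem right_mem_swapSet {i : ℕ} {D : Finset ℕ} : i + 1 ∈ swapSet i D ↔ i ∈ D := by
  rw [mem_swapSet, Equiv.swap_apply_right]

theorem mem_swapSet_of_ne {i t : ℕ} {D : Finset ℕ} (h1 : t ≠ i) (h2 : t ≠ i + 1) :
    t ∈ swapSet i D ↔ t ∈ D := by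
  rw [mem_swapSet, Equiv.swap_apply_of_ne_of_ne h1 h2]

@[simp] theorem swapSet_swapSet (i : ℕ) (D : Finset ℕ) : swapSet i (swapSet i D) = D := by
  ext t
  simp [mem_swapSet]

@[simp] theorem card_swapSet (i : ℕ) (D : Finset ℕ) : (swapSet i D).card = D.card :=
  Finset.card_map _

theorem swapSet_mono {i : ℕ} {D D' : Finset ℕ} (h : D ⊆ D') : swapSet i D ⊆ swapSet i D' :=
  Finset.map_subset_map.2 h

theorem swapSet_eq_self {i : ℕ} {D : Finset ℕ} (h : i ∈ D ↔ i + 1 ∈ D) : swapSet i D = D := by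
  ext t
  rcases eq_or_ne t i with rfl | h1
  · simp [h]
  rcases eq_or_ne t (i + 1) with rfl | h2
  · simp [h]
  exact mem_swapSet_of_ne h1 h2

theorem swapSet_subset_range {i n : ℕ} (hi : i + 1 < n) {D : Finset ℕ} :
    swapSet i D ⊆ Finset.range n ↔ D ⊆ Finset.range n := by
  have key : ∀ E : Finset ℕ, E ⊆ Finset.range n → swapSet i E ⊆ Finset.range n := by
    intro E hE t ht
    rw [Finset.mem_range]
    rcases eq_or_ne t i with rfl | h1
    · omega
    rcases eq_or_ne t (i + 1) with rfl | h2
    · omega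
    exact Finset.mem_range.1 (hE ((mem_swapSet_of_ne h1 h2).1 ht))
  exact ⟨fun h => by simpa using key _ h, key D⟩

/-- Two greedy matchings whose data agree away from `i` and `i + 1`, with the same number of
pending elements after `i + 1`, agree away from `i` and `i + 1`. -/
theorem mem_tri_congr {i t : ℕ} {C C' D D' : Finset ℕ} (h1 : t ≠ i) (h2 : t ≠ i + 1)
    (hC : ∀ s, s ≠ i → s ≠ i + 1 → (s ∈ C ↔ s ∈ C'))
    (hD : ∀ s, s ≠ i → s ≠ i + 1 → (s ∈ D ↔ s ∈ D'))
    (hp : pending C D i = pending C' D' i → pending C D (i + 2) = pending C' D' (i + 2)) :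
    t ∈ tri C D ↔ t ∈ tri C' D' := by
  have hlow : ∀ s ≤ i, pending C D s = pending C' D' s := fun s hs =>
    pending_congr (Nat.zero_le s) rfl fun u _ hu => ⟨hC u (by omega) (by omega),
      hD u (by omega) (by omega)⟩
  rw [mem_tri, mem_tri, hC t h1 h2]
  simp only [hD t h1 h2]
  rcases lt_or_ge t i with ht | ht
  · rw [hlow t ht.le]
  · rw [pending_congr (show i + 2 ≤ t by omega) (hp (hlow i le_rfl)) fun s hs _ =>
      ⟨hC s (by omega) (by omega), hD s (by omega) (by omega)⟩]

theorem pending_swap_eq {i : ℕ} {C C' D D' : Finset ℕ}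
    (hC : ∀ s, s ≠ i → s ≠ i + 1 → (s ∈ C ↔ s ∈ C'))
    (hD : ∀ s, s ≠ i → s ≠ i + 1 → (s ∈ D ↔ s ∈ D')) :
    pending C D i = pending C' D' i :=
  pending_congr (Nat.zero_le i) rfl fun u _ hu => ⟨hC u (by omega) (by omega),
      hD u (by omega) (by omega)⟩

/-- Nothing can be matched at i, so an element of D at i still waits at i + 1 and its exact position
is invisible. -/
theorem tri_swapSet_right {i : ℕ} {C : Finset ℕ} (hi : i ∉ C) (D : Finset ℕ) :
    tri C (swapSet i D) = tri C D := by
  have hD : ∀ s, s ≠ i → s ≠ i + 1 → (s ∈ swapSet i D ↔ s ∈ D) :=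
    fun s h1 h2 => mem_swapSet_of_ne h1 h2
  have hp := pending_swap_eq (i := i) (C := C) (C' := C) (fun s _ _ => Iff.rfl) hD
  ext t
  rcases eq_or_ne t i with rfl | h1
  · simp [mem_tri, hi]
  rcases eq_or_ne t (i + 1) with rfl | h2
  · simp only [mem_tri, pending, hp, left_mem_swapSet, right_mem_swapSet, hi, if_false]
    split_ifs <;> simp
  refine mem_tri_congr h1 h2 (fun s _ _ => Iff.rfl) hD fun h => ?_
  simp only [pending, h, left_mem_swapSet, right_mem_swapSet, hi, if_false]
  split_ifs <;> omega

/-- By `hD`, something is available at i + 1 only if something was already available at i. So the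
one element of C is used at i exactly when it would be used at i + 1. -/
theorem tri_swapSet_left {i : ℕ} {C D : Finset ℕ} (hi : i ∈ C) (hi' : i + 1 ∉ C)
    (hD : i + 1 ∈ D → i ∈ D) : tri (swapSet i C) D = swapSet i (tri C D) := by
  have hC : ∀ s, s ≠ i → s ≠ i + 1 → (s ∈ swapSet i C ↔ s ∈ C) :=
    fun s h1 h2 => mem_swapSet_of_ne h1 h2
  have hp := pending_swap_eq (i := i) (D := D) hC (fun s _ _ => Iff.rfl)
  ext t
  rcases eq_or_ne t i with rfl | h1
  · simp [mem_tri, hi']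
  rcases eq_or_ne t (i + 1) with rfl | h2
  · simp only [mem_tri, pending, hp, left_mem_swapSet, right_mem_swapSet, hi, hi', if_false,
      true_and]
    split_ifs <;> first | omega | tauto
  rw [mem_swapSet_of_ne h1 h2]
  refine mem_tri_congr h1 h2 hC (fun s _ _ => Iff.rfl) fun h => ?_
  simp only [pending, h, left_mem_swapSet, right_mem_swapSet, hi, hi', if_false, if_true]
  split_ifs <;> first | omega | tauto

theorem left_mem_tri_of_right {i : ℕ} {C D : Finset ℕ} (hi : i ∈ C)
    (hD : i + 1 ∈ D → i ∈ D) : i + 1 ∈ tri C D → i ∈ tri C D := by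
  simp only [mem_tri, pending, hi, if_true, true_and]
  rintro ⟨-, h⟩
  split_ifs at * <;> first | omega | tauto

/-- If D contains just i, the number waiting before i decides. If it is zero, i and i + 1 serve only
their own arrivals and the result moves with D; if positive, both are used in either case. -/
theorem tri_swapSet_right_or {i : ℕ} {C D : Finset ℕ} (hi : i ∈ C) (hi' : i + 1 ∈ C)
    (hD : i + 1 ∈ D → i ∈ D) :
    tri C (swapSet i D) = tri C D ∨ tri C (swapSet i D) = swapSet i (tri C D) := by
  by_cases hs : i ∈ D ↔ i + 1 ∈ D
  · rw [swapSet_eq_self hs]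
    exact Or.inl rfl
  have h0 : i ∈ D := by tauto
  have h1 : i + 1 ∉ D := by tauto
  have hDs : ∀ s, s ≠ i → s ≠ i + 1 → (s ∈ swapSet i D ↔ s ∈ D) :=
    fun s h1 h2 => mem_swapSet_of_ne h1 h2
  have hp := pending_swap_eq (i := i) (C := C) (C' := C) (fun s _ _ => Iff.rfl) hDs
  have hoff : ∀ t, t ≠ i → t ≠ i + 1 → (t ∈ tri C (swapSet i D) ↔ t ∈ tri C D) := by
    intro t h2 h3
    refine mem_tri_congr h2 h3 (fun s _ _ => Iff.rfl) hDs fun h => ?_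
    simp only [pending, h, left_mem_swapSet, right_mem_swapSet, hi, hi', h0, h1, if_false, if_true]
    omega
  rcases Nat.eq_zero_or_pos (pending C D i) with hz | hz
  · right
    ext t
    rcases eq_or_ne t i with rfl | h2
    · simp [mem_tri, pending, hp, h0, h1, hi, hi', hz]
    rcases eq_or_ne t (i + 1) with rfl | h3
    · simp [mem_tri, pending, h0, hi, hi']
    rw [hoff t h2 h3, mem_swapSet_of_ne h2 h3]
  · left
    ext t
    rcases eq_or_ne t i with rfl | h2
    · simp [mem_tri, hp, h0, h1, hi, hz]
    rcases eq_or_ne t (i + 1) with rfl | h3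
    · simp [mem_tri, pending, h0, h1, hi, hi', hz]
    exact hoff t h2 h3

/-! ### Bruhat order and its lifting property. -/

theorem swapComp_swapComp (i j : ℕ) (α : Comp) : swapComp i j (swapComp i j α) = α := by
  ext k
  simp [swapComp_apply]

theorem bruhatLE_swapComp {a b : ℕ} {γ : Comp} (hab : a < b) (h : γ b < γ a) :
    BruhatLE γ (swapComp a b γ) :=
  Relation.ReflTransGen.single ⟨a, b, hab, h, rfl⟩

theorem swapComp_eq_self {a b : ℕ} {γ : Comp} (h : γ a = γ b) : swapComp a b γ = γ := by
  ext k
  rw [swapComp_apply]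
  rcases eq_or_ne k a with rfl | h1
  · rw [Equiv.swap_apply_left, h]
  rcases eq_or_ne k b with rfl | h2
  · rw [Equiv.swap_apply_right, h]
  rw [Equiv.swap_apply_of_ne_of_ne h1 h2]

/-- The smaller one, in Bruhat order, of `γ` and `s_i γ`. -/
def descComp (i : ℕ) (γ : Comp) : Comp := if γ i < γ (i + 1) then swapComp i (i + 1) γ else γ

/-- The larger one, in Bruhat order, of `γ` and `s_i γ`. -/
def ascComp (i : ℕ) (γ : Comp) : Comp := if γ (i + 1) < γ i then swapComp i (i + 1) γ else γ

theorem descComp_le (i : ℕ) (γ : Comp) : BruhatLE (descComp i γ) γ := by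
  rw [descComp]
  split_ifs with h
  · have := bruhatLE_swapComp (γ := swapComp i (i + 1) γ) (Nat.lt_succ_self i)
      (by simpa [swapComp_apply] using h)
    rwa [swapComp_swapComp] at this
  · exact Relation.ReflTransGen.refl

theorem le_ascComp (i : ℕ) (γ : Comp) : BruhatLE γ (ascComp i γ) := by
  rw [ascComp]
  split_ifs with h
  · exact bruhatLE_swapComp (Nat.lt_succ_self i) h
  · exact Relation.ReflTransGen.refl

theorem descComp_swapComp (i : ℕ) (γ : Comp) :
    descComp i (swapComp i (i + 1) γ) = descComp i γ := by
  simp only [descComp, swapComp_apply, Equiv.swap_apply_left, Equiv.swap_apply_right,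
    swapComp_swapComp]
  split_ifs with h1 h2 h2
  · omega
  · rfl
  · rfl
  · exact swapComp_eq_self (by omega)

theorem ascComp_swapComp (i : ℕ) (γ : Comp) :
    ascComp i (swapComp i (i + 1) γ) = ascComp i γ := by
  simp only [ascComp, swapComp_apply, Equiv.swap_apply_left, Equiv.swap_apply_right,
    swapComp_swapComp]
  split_ifs with h1 h2 h2
  · omega
  · rfl
  · rfl
  · exact swapComp_eq_self (by omega)

theorem descComp_le_swapComp (i : ℕ) (γ : Comp) :
    BruhatLE (descComp i γ) (swapComp i (i + 1) γ) :=
  descComp_swapComp i γ ▸ descComp_le i _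

theorem swapComp_le_ascComp (i : ℕ) (γ : Comp) :
    BruhatLE (swapComp i (i + 1) γ) (ascComp i γ) :=
  ascComp_swapComp i γ ▸ le_ascComp i _

/-- A transposition other than `s_i` that goes up in Bruhat order still does so after applying
`s_i` to both sides. -/
theorem swapComp_le_swapComp {i a b : ℕ} {γ : Comp} (hab : a < b) (h : γ b < γ a)
    (hne : ¬ (a = i ∧ b = i + 1)) :
    BruhatLE (swapComp i (i + 1) γ) (swapComp i (i + 1) (swapComp a b γ)) := by
  refine Relation.ReflTransGen.single
    ⟨Equiv.swap i (i + 1) a, Equiv.swap i (i + 1) b, ?_, ?_, ?_⟩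
  -- The simple transposition reverses the order of two positions only if they are i and i + 1,
  -- which `hne` excludes.
  · simp only [Equiv.swap_apply_def]
    split_ifs <;> omega
  · simpa [swapComp_apply] using h
  · ext k
    simp only [swapComp_apply]
    congr 1
    have := Equiv.swap_apply_apply (Equiv.swap i (i + 1)) a b
    rw [this]
    simp

/-- On a step of the order given by another transposition, s_i can be applied to both ends; a step
given by s_i itself is absorbed by `descComp`. -/
theorem descComp_mono (i : ℕ) {γ δ : Comp} (h : BruhatLE γ δ) :
    BruhatLE (descComp i γ) (descComp i δ) := by
  induction h with
  | refl => exact Relation.ReflTransGen.refl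
  | @tail γ' δ' _ h ih =>
    refine ih.trans ?_
    obtain ⟨a, b, hab, hlt, rfl⟩ := h
    by_cases hne : a = i ∧ b = i + 1
    · obtain ⟨rfl, rfl⟩ := hne
      rw [descComp_swapComp]
    · rw [descComp.eq_1 i (swapComp a b γ')]
      split_ifs
      · exact (descComp_le_swapComp i γ').trans (swapComp_le_swapComp hab hlt hne)
      · exact (descComp_le i γ').trans (bruhatLE_swapComp hab hlt)

theorem ascComp_mono (i : ℕ) {γ δ : Comp} (h : BruhatLE γ δ) :
    BruhatLE (ascComp i γ) (ascComp i δ) := by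
  induction h with
  | refl => exact Relation.ReflTransGen.refl
  | @tail γ' δ' _ h ih =>
    refine ih.trans ?_
    obtain ⟨a, b, hab, hlt, rfl⟩ := h
    by_cases hne : a = i ∧ b = i + 1
    · obtain ⟨rfl, rfl⟩ := hne
      rw [ascComp_swapComp]
    · rw [ascComp.eq_1 i γ']
      split_ifs
      · exact (swapComp_le_swapComp hab hlt hne).trans (swapComp_le_ascComp i _)
      · exact (bruhatLE_swapComp hab hlt).trans (le_ascComp i _)

/-- An ascent makes α its own `ascComp`, so the ideal below α is stable under s_i. Dually, in
`le_swapComp_of_le` the lower element is its own `descComp`. -/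
theorem swapComp_le_of_le {i : ℕ} {κ α : Comp} (hα : α i < α (i + 1)) (h : BruhatLE κ α) :
    BruhatLE (swapComp i (i + 1) κ) α := by
  have h1 := (swapComp_le_ascComp i κ).trans (ascComp_mono i h)
  rwa [ascComp, if_neg (by omega)] at h1

theorem le_swapComp_of_le {i : ℕ} {κ α : Comp} (hα : α i < α (i + 1)) (hκ : κ (i + 1) ≤ κ i)
    (h : BruhatLE κ α) : BruhatLE κ (swapComp i (i + 1) α) := by
  have h1 := descComp_mono i h
  rwa [descComp, descComp, if_pos hα, if_neg (by omega)] at h1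

theorem eq_of_le_antitone {κ α : Comp} (hα : Antitone α) (h : BruhatLE κ α) : κ = α := by
  rcases Relation.ReflTransGen.cases_tail h with h | ⟨γ, -, a, b, hab, hlt, rfl⟩
  · exact h.symm
  · have := hα hab.le
    simp only [swapComp_apply, Equiv.swap_apply_left, Equiv.swap_apply_right] at this
    omega

/-- A step up moves a larger part to the right, so the last nonzero position never decreases. This
bounds the entries of the tableaux and gives finiteness. -/
theorem support_subset_of_le {N : ℕ} {κ α : Comp} (h : BruhatLE κ α)
    (hα : α.support ⊆ Finset.range N) : κ.support ⊆ Finset.range N := by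
  induction h with
  | refl => exact hα
  | @tail γ δ _ h ih =>
    apply ih
    obtain ⟨a, b, hab, hlt, rfl⟩ := h
    have hb : b < N := Finset.mem_range.1 (hα (by
      rw [Finsupp.mem_support_iff, swapComp_apply, Equiv.swap_apply_right]
      omega))
    intro k hk
    rw [Finset.mem_range]
    rcases eq_or_ne k a with rfl | h1
    · omega
    rcases eq_or_ne k b with rfl | h2
    · exact hb
    refine Finset.mem_range.1 (hα ?_)
    rw [Finsupp.mem_support_iff] at hk ⊢
    rwa [swapComp_apply, Equiv.swap_apply_of_ne_of_ne h1 h2]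

theorem support_swapComp_subset {i N : ℕ} {α : Comp} (hi : i + 1 < N)
    (hα : α.support ⊆ Finset.range N) :
    (swapComp i (i + 1) α).support ⊆ Finset.range N := by
  intro k hk
  rw [Finset.mem_range]
  rcases eq_or_ne k i with rfl | h1
  · omega
  rcases eq_or_ne k (i + 1) with rfl | h2
  · exact hi
  refine Finset.mem_range.1 (hα ?_)
  rw [Finsupp.mem_support_iff] at hk ⊢
  rwa [swapComp_apply, Equiv.swap_apply_of_ne_of_ne h1 h2] at hk

/-! ### Algebra of π_i and π_i − 1. -/

theorem piBeta_eq_of_mul_eq {i : ℕ} {f q : LRing}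
    (h : (X i - X (i + 1)) * q =
      X i * (1 + betaVar * X (i + 1)) * f - X (i + 1) * (1 + betaVar * X i) * sPoly i f) :
    piBeta i f = q :=
  mul_left_cancel₀ (X_sub_X_ne (show i ≠ i + 1 by omega)) ((piBeta_spec i f).trans h.symm)

theorem piBeta_add (i : ℕ) (f g : LRing) : piBeta i (f + g) = piBeta i f + piBeta i g := by
  apply piBeta_eq_of_mul_eq
  rw [map_add]
  linear_combination piBeta_spec i f + piBeta_spec i g

theorem piBeta_zero (i : ℕ) : piBeta i 0 = 0 := by
  apply piBeta_eq_of_mul_eq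
  simp

theorem piBeta_mul (i : ℕ) {h : LRing} (hh : sPoly i h = h) (g : LRing) :
    piBeta i (h * g) = h * piBeta i g := by
  apply piBeta_eq_of_mul_eq
  rw [map_mul, hh]
  linear_combination h * piBeta_spec i g

theorem piBeta_of_symm (i : ℕ) {h : LRing} (hh : sPoly i h = h) : piBeta i h = h := by
  apply piBeta_eq_of_mul_eq
  rw [hh]
  ring

theorem sPoly_one_add (i : ℕ) : sPoly i (1 + betaVar * X i) = 1 + betaVar * X (i + 1) := by
  simp only [map_add, map_mul, map_one, sPoly_beta, sPoly_X_self]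

theorem sPoly_one_add_succ (i : ℕ) : sPoly i (1 + betaVar * X (i + 1)) = 1 + betaVar * X i := by
  simp only [map_add, map_mul, map_one, sPoly_beta, sPoly_X_succ]

theorem sPoly_piBeta (i : ℕ) (g : LRing) : sPoly i (piBeta i g) = piBeta i g := by
  apply mul_left_cancel₀ (X_sub_X_ne (show i ≠ i + 1 by omega))
  have h := piBeta_spec i g
  have h' := congrArg (sPoly i) h
  simp only [map_mul, map_sub, sPoly_one_add, sPoly_one_add_succ, sPoly_X_self, sPoly_X_succ,
    sPoly_sPoly] at h'
  linear_combination -h - h'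

/-- The operator `π^{(β)}_i - 1`. -/
def barBeta (i : ℕ) (g : LRing) : LRing := piBeta i g - g

theorem barBeta_of_symm (i : ℕ) {h : LRing} (hh : sPoly i h = h) : barBeta i h = 0 := by
  rw [barBeta, piBeta_of_symm i hh, sub_self]

theorem barBeta_mul (i : ℕ) {h : LRing} (hh : sPoly i h = h) (g : LRing) :
    barBeta i (h * g) = h * barBeta i g := by
  rw [barBeta, barBeta, piBeta_mul i hh]
  ring

theorem add_barBeta (i : ℕ) (g : LRing) : g + barBeta i g = piBeta i g := by
  rw [barBeta]
  ring

theorem piBeta_barBeta (i : ℕ) (g : LRing) : piBeta i (barBeta i g) = 0 := by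
  have h := piBeta_add i g (barBeta i g)
  rw [add_barBeta, piBeta_of_symm i (sPoly_piBeta i g)] at h
  exact left_eq_add.1 h

/-- The sum equals βx_i(1 + βx_{i+1})g + (1 + βx_{i+1})π_i g. Subtracting the s_i-image, the first
term gives β(x_i − x_{i+1})π_i g by definition of π_i and the second gives its negative. -/
theorem sPoly_mul_add_mul_barBeta (i : ℕ) (g : LRing) :
    sPoly i ((1 + betaVar * X i) * (1 + betaVar * X (i + 1)) * g +
        (1 + betaVar * X (i + 1)) * barBeta i g) =
      (1 + betaVar * X i) * (1 + betaVar * X (i + 1)) * g +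
        (1 + betaVar * X (i + 1)) * barBeta i g := by
  simp only [barBeta, map_add, map_mul, map_sub, sPoly_piBeta, map_one, sPoly_beta, sPoly_X_self,
    sPoly_X_succ]
  linear_combination betaVar * piBeta_spec i g

/-- This is π_i(π_i − 1) = 0 rewritten: π_i h vanishes exactly when x_i(1 + βx_{i+1})h is symmetric.
-/
theorem sPoly_X_mul_barBeta (i : ℕ) (g : LRing) :
    sPoly i (X i * (1 + betaVar * X (i + 1)) * barBeta i g) =
      X i * (1 + betaVar * X (i + 1)) * barBeta i g := by
  simp only [barBeta, map_add, map_mul, map_sub, sPoly_piBeta, map_one, sPoly_beta, sPoly_X_self,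
    sPoly_X_succ]
  linear_combination - piBeta_spec i g

/-- This rule and `barBeta_X_mul` fit the two local factors x_i(1 + βx_{i+1}) and x_i of a column
containing i but not i + 1. -/
theorem barBeta_X_mul_one_add (i : ℕ) (g : LRing) :
    barBeta i (X i * (1 + betaVar * X (i + 1)) * g) =
      X (i + 1) * (1 + betaVar * X i) * piBeta i g := by
  rw [barBeta, sub_eq_iff_eq_add]
  apply piBeta_eq_of_mul_eq
  simp only [map_add, map_mul, map_one, sPoly_beta, sPoly_X_self, sPoly_X_succ]
  linear_combination X (i + 1) * (1 + betaVar * X i) * piBeta_spec i g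

theorem barBeta_X_mul (i : ℕ) (g : LRing) :
    barBeta i (X i * g) = X (i + 1) * ((1 + betaVar * X i) * g + barBeta i g) := by
  rw [barBeta, sub_eq_iff_eq_add]
  apply piBeta_eq_of_mul_eq
  simp only [barBeta, map_mul, sPoly_X_self]
  linear_combination X (i + 1) * piBeta_spec i g

/-! ### Weights of a column followed by another. -/

/-- The number of elements of `C` that are at least `t`. -/
def cnt (t : ℕ) (C : Finset ℕ) : ℕ := (C.filter (t ≤ ·)).card

theorem cnt_eq (t : ℕ) (C : Finset ℕ) : cnt t C = cnt (t + 1) C + if t ∈ C then 1 else 0 := by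
  have h : C.filter (t ≤ ·) = C.filter (t + 1 ≤ ·) ∪ C.filter (t = ·) := by
    ext s
    simp only [Finset.mem_filter, Finset.mem_union]
    rw [← and_or_left, Nat.add_one_le_iff, le_iff_lt_or_eq]
  rw [cnt, h, Finset.card_union_of_disjoint, cnt, Finset.filter_eq]
  · split_ifs <;> simp
  · refine Finset.disjoint_filter.2 fun s _ h1 h2 => ?_
    omega

theorem cnt_swapSet {i t : ℕ} (ht : t ≠ i + 1) (C : Finset ℕ) :
    cnt t (swapSet i C) = cnt t C := by
  rw [cnt, swapSet, Finset.filter_map, Finset.card_map, cnt]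
  congr 1
  refine Finset.filter_congr fun s _ => ?_
  simp only [Function.comp_apply, Equiv.coe_toEmbedding, Equiv.swap_apply_def]
  split_ifs <;> omega

/-- `C` and `C'` can be adjacent columns of a reverse semistandard tableau: the `r`-th largest
element of `C'`, if there is one, is at most the `r`-th largest element of `C`. -/
def Dominates (C C' : Finset ℕ) : Prop := ∀ t, cnt t C' ≤ cnt t C

open Classical in
/-- The contribution to the weight of a column `C` followed by the column `C'`, all entries being
smaller than `N`. -/
def colWeight (N : ℕ) (C C' : Finset ℕ) : LRing :=
  (∏ a ∈ C, X a) * ∏ k ∈ (Finset.range N).filter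
    (fun k => k ∉ C ∧ cnt (k + 1) C' < cnt (k + 1) C), (1 + betaVar * X k)

open Classical in
/-- The contribution to the weight of a column `C` followed by the column `C'`, or zero if these
columns are incompatible. -/
def colCoeff (N : ℕ) (C C' : Finset ℕ) : LRing :=
  if Dominates C C' then colWeight N C C' else 0

open Classical in
/-- The part of `colCoeff N C C'` not involving `x_i` and `x_{i+1}`. -/
def offCoeff (i N : ℕ) (C C' : Finset ℕ) : LRing :=
  if ∀ t, t ≠ i + 1 → cnt t C' ≤ cnt t C then
    (∏ a ∈ (C.erase i).erase (i + 1), X a) * ∏ k ∈ (((Finset.range N).filter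
      (fun k => k ∉ C ∧ cnt (k + 1) C' < cnt (k + 1) C)).erase i).erase (i + 1),
        (1 + betaVar * X k)
  else 0

theorem prod_eq_prod_erase_erase {R : Type*} [CommMonoid R] (s : Finset ℕ) (i : ℕ) (f : ℕ → R) :
    ∏ a ∈ s, f a = (∏ a ∈ (s.erase i).erase (i + 1), f a) *
      ((if i ∈ s then f i else 1) * (if i + 1 ∈ s then f (i + 1) else 1)) := by
  have h : ∀ (s : Finset ℕ) j, ∏ a ∈ s, f a = (∏ a ∈ s.erase j, f a) * if j ∈ s then f j else 1 := by
    intro s j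
    split_ifs with hj
    · exact (Finset.prod_erase_mul s f hj).symm
    · rw [Finset.erase_eq_of_notMem hj, mul_one]
  rw [h s i, h (s.erase i) (i + 1)]
  simp only [Finset.mem_erase, ne_eq, Nat.succ_ne_self, not_false_eq_true, true_and]
  rw [mul_assoc, mul_comm (ite _ _ _) (ite _ _ _)]

theorem sPoly_offCoeff (i N : ℕ) (C C' : Finset ℕ) :
    sPoly i (offCoeff i N C C') = offCoeff i N C C' := by
  rw [offCoeff]
  split_ifs
  · rw [map_mul, map_prod, map_prod]
    congr 1
    · refine Finset.prod_congr rfl fun a ha => ?_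
      simp only [Finset.mem_erase] at ha
      exact sPoly_X_of_ne ha.2.1 ha.1
    · refine Finset.prod_congr rfl fun a ha => ?_
      simp only [Finset.mem_erase] at ha
      rw [map_add, map_mul, map_one, sPoly_beta, sPoly_X_of_ne ha.2.1 ha.1]
  · exact map_zero _

open Classical in
-- The simple transposition changes `cnt t` only at t = i + 1, a value that `offCoeff` never uses.
theorem offCoeff_swapSet_right (i N : ℕ) (C C' : Finset ℕ) :
    offCoeff i N C (swapSet i C') = offCoeff i N C C' := by
  have h1 : (∀ t, t ≠ i + 1 → cnt t (swapSet i C') ≤ cnt t C) ↔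
      ∀ t, t ≠ i + 1 → cnt t C' ≤ cnt t C :=
    forall_congr' fun t => imp_congr_right fun ht => by rw [cnt_swapSet ht]
  rw [offCoeff, offCoeff]
  refine if_congr h1 (congrArg₂ (· * ·) rfl (Finset.prod_congr ?_ fun _ _ => rfl)) rfl
  ext k
  simp only [Finset.mem_erase, Finset.mem_filter]
  refine and_congr_right fun _ => and_congr_right fun h => ?_
  rw [cnt_swapSet (by omega)]

open Classical in
theorem offCoeff_swapSet_left (i N : ℕ) (C C' : Finset ℕ) :
    offCoeff i N (swapSet i C) C' = offCoeff i N C C' := by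
  have h1 : (∀ t, t ≠ i + 1 → cnt t C' ≤ cnt t (swapSet i C)) ↔
      ∀ t, t ≠ i + 1 → cnt t C' ≤ cnt t C :=
    forall_congr' fun t => imp_congr_right fun ht => by rw [cnt_swapSet ht]
  rw [offCoeff, offCoeff]
  refine if_congr h1 (congrArg₂ (· * ·) (Finset.prod_congr ?_ fun _ _ => rfl)
    (Finset.prod_congr ?_ fun _ _ => rfl)) rfl
  · ext k
    simp only [Finset.mem_erase]
    exact and_congr_right fun h => and_congr_right fun h' => mem_swapSet_of_ne h' h
  · ext k
    simp only [Finset.mem_erase, Finset.mem_filter]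
    refine and_congr_right fun h => and_congr_right fun h' => ?_
    rw [cnt_swapSet (by omega), mem_swapSet_of_ne h' h]

theorem offCoeff_eq_zero_or (i N : ℕ) (C C' : Finset ℕ) :
    offCoeff i N C C' = 0 ∨ (cnt (i + 2) C' ≤ cnt (i + 2) C ∧ cnt i C' ≤ cnt i C) := by
  by_cases h : ∀ t, t ≠ i + 1 → cnt t C' ≤ cnt t C
  · exact Or.inr ⟨h _ (by omega), h _ (by omega)⟩
  · exact Or.inl (if_neg h)

open Classical in
theorem colCoeff_eq {i N : ℕ} (hi : i + 1 < N) (C C' : Finset ℕ) :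
    colCoeff N C C' = offCoeff i N C C' *
      if cnt (i + 1) C' ≤ cnt (i + 1) C then
        (if i ∈ C then X i else if cnt (i + 1) C' < cnt (i + 1) C then 1 + betaVar * X i else 1) *
        (if i + 1 ∈ C then X (i + 1)
          else if cnt (i + 2) C' < cnt (i + 2) C then 1 + betaVar * X (i + 1) else 1)
      else 0 := by
  by_cases h0 : ∀ t, t ≠ i + 1 → cnt t C' ≤ cnt t C
  · by_cases h1 : cnt (i + 1) C' ≤ cnt (i + 1) C
    · have hd : Dominates C C' := fun t => by
        rcases eq_or_ne t (i + 1) with rfl | ht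
        · exact h1
        · exact h0 t ht
      rw [colCoeff, if_pos hd, offCoeff, if_pos h0, if_pos h1, colWeight,
        prod_eq_prod_erase_erase C i, prod_eq_prod_erase_erase (Finset.filter _ _) i]
      simp only [Finset.mem_filter, Finset.mem_range, (Nat.lt_succ_self i).trans hi, hi, true_and]
      by_cases hC : i ∈ C <;> by_cases hC' : i + 1 ∈ C <;>
        simp only [hC, hC', not_true_eq_false, not_false_eq_true, false_and, true_and, if_true,
          if_false] <;> ring
    · rw [colCoeff, if_neg fun hd => h1 (hd _), if_neg h1, mul_zero]
  · rw [colCoeff, if_neg fun hd => h0 fun t _ => hd t, offCoeff, if_neg h0, zero_mul]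

/-! ### Keys as lists of columns. -/

/-- Formal combinations of keys, written as lists of columns. -/
abbrev KeySum := List (Finset ℕ) →₀ LRing

/-- The list of columns of the left key obtained by adding a column on the left. -/
def keyCons (C : Finset ℕ) (κ : List (Finset ℕ)) : List (Finset ℕ) := C :: κ.map (tri C)

/-- The action of `s_i` on keys. -/
def swapKey (i : ℕ) (κ : List (Finset ℕ)) : List (Finset ℕ) := κ.map (swapSet i)

/-- A key whose columns form a decreasing chain and in which no column contains `i + 1` without
containing `i`. -/
structure IsDominantKey (i : ℕ) (κ : List (Finset ℕ)) : Prop where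
  chain : κ.Pairwise fun D E => E ⊆ D
  dominant : ∀ D ∈ κ, i + 1 ∈ D → i ∈ D

theorem keyCons_chain (C : Finset ℕ) {κ : List (Finset ℕ)} (h : κ.Pairwise fun D E => E ⊆ D) :
    (keyCons C κ).Pairwise fun D E => E ⊆ D := by
  refine List.pairwise_cons.2 ⟨fun E hE => ?_, h.map _ fun D E hDE => tri_mono C hDE⟩
  obtain ⟨D, -, rfl⟩ := List.mem_map.1 hE
  exact tri_subset C D

theorem swapKey_chain (i : ℕ) {κ : List (Finset ℕ)} (h : κ.Pairwise fun D E => E ⊆ D) :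
    (swapKey i κ).Pairwise fun D E => E ⊆ D :=
  h.map _ fun _ _ hDE => swapSet_mono hDE

theorem subset_of_mem_keyCons {C D : Finset ℕ} {κ : List (Finset ℕ)} (h : D ∈ keyCons C κ) :
    D ⊆ C := by
  rcases List.mem_cons.1 h with rfl | h
  · exact Finset.Subset.refl _
  · obtain ⟨E, -, rfl⟩ := List.mem_map.1 h
    exact tri_subset C E

theorem isDominantKey_keyCons_of_notMem {i : ℕ} {C : Finset ℕ} (hC : i + 1 ∉ C)
    {κ : List (Finset ℕ)} (h : κ.Pairwise fun D E => E ⊆ D) : IsDominantKey i (keyCons C κ) :=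
  ⟨keyCons_chain C h, fun _ hD hi => absurd (subset_of_mem_keyCons hD hi) hC⟩

theorem isDominantKey_keyCons_of_mem {i : ℕ} {C : Finset ℕ} (hC : i ∈ C)
    {κ : List (Finset ℕ)} (h : IsDominantKey i κ) : IsDominantKey i (keyCons C κ) := by
  refine ⟨keyCons_chain C h.chain, fun D hD => ?_⟩
  rcases List.mem_cons.1 hD with rfl | hD
  · exact fun _ => hC
  · obtain ⟨E, hE, rfl⟩ := List.mem_map.1 hD
    exact left_mem_tri_of_right hC (h.dominant E hE)

theorem keyCons_swapKey {i : ℕ} {C : Finset ℕ} (hC : i ∉ C) (κ : List (Finset ℕ)) :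
    keyCons C (swapKey i κ) = keyCons C κ := by
  rw [keyCons, swapKey, List.map_map, keyCons]
  congr 2
  funext D
  exact tri_swapSet_right hC D

theorem keyCons_swapSet {i : ℕ} {C : Finset ℕ} (hC : i ∈ C) (hC' : i + 1 ∉ C)
    {κ : List (Finset ℕ)} (h : IsDominantKey i κ) :
    keyCons (swapSet i C) κ = swapKey i (keyCons C κ) := by
  rw [keyCons, swapKey, keyCons, List.map_cons, List.map_map]
  congr 1
  exact List.map_congr_left fun D hD => tri_swapSet_left hC hC' (h.dominant D hD)

/-- Each column separately either ignores or follows s_i. The columns form a chain and ◁ preserves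
inclusions, so a result containing only i + 1 cannot coexist with one containing only i; hence all
columns make the same choice. -/
theorem keyCons_swapKey_or {i : ℕ} {C : Finset ℕ} (hC : i ∈ C) (hC' : i + 1 ∈ C)
    {κ : List (Finset ℕ)} (h : IsDominantKey i κ) :
    keyCons C (swapKey i κ) = keyCons C κ ∨
      keyCons C (swapKey i κ) = swapKey i (keyCons C κ) := by
  have only : ∀ D ∈ κ, swapSet i (tri C D) ≠ tri C D → i ∈ tri C D ∧ i + 1 ∉ tri C D := by
    intro D hD hne
    have h1 := left_mem_tri_of_right hC (h.dominant D hD)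
    have h2 : ¬ (i ∈ tri C D ↔ i + 1 ∈ tri C D) := fun h => hne (swapSet_eq_self h)
    tauto
  by_cases hall : ∀ D ∈ κ, tri C (swapSet i D) = tri C D
  · left
    rw [keyCons, swapKey, List.map_map, keyCons]
    congr 1
    exact List.map_congr_left hall
  right
  push Not at hall
  obtain ⟨D, hD, hne⟩ := hall
  have hDs := (tri_swapSet_right_or hC hC' (h.dominant D hD)).resolve_left hne
  have hD' := only D hD (hDs ▸ hne)
  rw [keyCons, swapKey, List.map_map, keyCons, swapKey, List.map_cons,
    swapSet_eq_self (iff_of_true hC hC'), List.map_map]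
  congr 1
  refine List.map_congr_left fun E hE => ?_
  rcases tri_swapSet_right_or hC hC' (h.dominant E hE) with hEs | hEs
  · simp only [Function.comp_apply]
    by_contra hE2
    have hE' := only E hE fun h => hE2 (hEs.trans h.symm)
    have hsymm : Std.Symm fun D E : Finset ℕ => D ⊆ E ∨ E ⊆ D := ⟨fun _ _ => Or.symm⟩
    have hcomp : D ⊆ E ∨ E ⊆ D :=
      List.Pairwise.forall_of_forall (R := fun D E : Finset ℕ => D ⊆ E ∨ E ⊆ D)
        (fun _ _ => Or.inl (Finset.Subset.refl _))
        (h.chain.imp Or.inr) hD hE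
    have hcomp2 : tri C (swapSet i D) ⊆ tri C (swapSet i E) ∨
        tri C (swapSet i E) ⊆ tri C (swapSet i D) :=
      hcomp.imp (fun h => tri_mono C (swapSet_mono h)) fun h => tri_mono C (swapSet_mono h)
    rw [hDs, hEs] at hcomp2
    rcases hcomp2 with h | h
    · exact hE'.2 (h (right_mem_swapSet.2 hD'.1))
    · exact hD'.2 (left_mem_swapSet.1 (h hE'.1))
  · exact hEs

/-! ### The classes of formal sums preserved by adding columns. -/

/-- Pairs `(g κ, (π_i - 1)(g) s_i κ)` with a dominant key `κ`. -/
def atomPairs (i : ℕ) : AddSubmonoid (KeySum × KeySum) :=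
  AddSubmonoid.closure {p | ∃ g κ, IsDominantKey i κ ∧
    p = (Finsupp.single κ g, Finsupp.single (swapKey i κ) (barBeta i g))}

/-- Combinations of the elements `g κ + (π_i - 1)(g) s_i κ` with a dominant key `κ`. -/
def atomSums (i : ℕ) : AddSubmonoid KeySum :=
  AddSubmonoid.closure {p | ∃ g κ, IsDominantKey i κ ∧
    p = Finsupp.single κ g + Finsupp.single (swapKey i κ) (barBeta i g)}

/-- Combinations of the elements `g κ` with `g` symmetric and `κ` not involving `i` and `i + 1`. -/
def symmSums (i : ℕ) : AddSubmonoid KeySum :=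
  AddSubmonoid.closure {p | ∃ g κ, sPoly i g = g ∧ κ.Pairwise (fun D E => E ⊆ D) ∧
    (∀ D ∈ κ, i ∉ D ∧ i + 1 ∉ D) ∧ p = Finsupp.single κ g}

theorem map_mem_of_closure {A B : Type*} [AddCommMonoid A] [AddCommMonoid B] [Module LRing A]
    [Module LRing B] (f : A →ₗ[LRing] B) {S : Set A} {T : AddSubmonoid B}
    (h : ∀ x ∈ S, f x ∈ T) {x : A} (hx : x ∈ AddSubmonoid.closure S) : f x ∈ T :=
  (AddSubmonoid.closure_le.2 (show S ⊆ T.comap f from h)) hx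

theorem single_mem_symmSums {i : ℕ} {g : LRing} {κ : List (Finset ℕ)} (hg : sPoly i g = g)
    (hκ : κ.Pairwise fun D E => E ⊆ D) (h : ∀ D ∈ κ, i ∉ D ∧ i + 1 ∉ D) :
    Finsupp.single κ g ∈ symmSums i :=
  AddSubmonoid.subset_closure ⟨g, κ, hg, hκ, h, rfl⟩

theorem single_add_single_mem_atomSums {i : ℕ} (g : LRing) {κ : List (Finset ℕ)}
    (h : IsDominantKey i κ) :
    Finsupp.single κ g + Finsupp.single (swapKey i κ) (barBeta i g) ∈ atomSums i :=
  AddSubmonoid.subset_closure ⟨g, κ, h, rfl⟩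

theorem single_mem_atomSums {i : ℕ} {g : LRing} {κ : List (Finset ℕ)} (hg : sPoly i g = g)
    (h : IsDominantKey i κ) : Finsupp.single κ g ∈ atomSums i := by
  simpa [barBeta_of_symm i hg] using single_add_single_mem_atomSums g h

theorem mk_mem_atomPairs {i : ℕ} (g : LRing) {κ : List (Finset ℕ)} (h : IsDominantKey i κ) :
    (Finsupp.single κ g, Finsupp.single (swapKey i κ) (barBeta i g)) ∈ atomPairs i :=
  AddSubmonoid.subset_closure ⟨g, κ, h, rfl⟩

theorem mk_zero_mem_atomPairs {i : ℕ} {g : LRing} {κ : List (Finset ℕ)} (hg : sPoly i g = g)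
    (h : IsDominantKey i κ) : (Finsupp.single κ g, 0) ∈ atomPairs i := by
  simpa [barBeta_of_symm i hg] using mk_mem_atomPairs g h

theorem symmSums_le_atomSums (i : ℕ) : symmSums i ≤ atomSums i := by
  refine AddSubmonoid.closure_le.2 ?_
  rintro _ ⟨g, κ, hg, hκ, h, rfl⟩
  exact single_mem_atomSums hg ⟨hκ, fun D hD hi => absurd hi (h D hD).2⟩

theorem add_mem_atomSums {i : ℕ} {p : KeySum × KeySum} (hp : p ∈ atomPairs i) :
    p.1 + p.2 ∈ atomSums i := by
  refine map_mem_of_closure (LinearMap.coprod LinearMap.id LinearMap.id) ?_ hp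
  rintro _ ⟨g, κ, h, rfl⟩
  exact single_add_single_mem_atomSums g h

/-- The effect on sums over tableaux of adding the column `C` to the left of `C'`. -/
def addCol (N : ℕ) (C C' : Finset ℕ) : KeySum →ₗ[LRing] KeySum :=
  colCoeff N C C' • Finsupp.lmapDomain LRing LRing (keyCons C)

theorem addCol_single (N : ℕ) (C C' : Finset ℕ) (κ : List (Finset ℕ)) (g : LRing) :
    addCol N C C' (Finsupp.single κ g) =
      Finsupp.single (keyCons C κ) (colCoeff N C C' * g) := by
  simp [addCol, Finsupp.lmapDomain_apply, Finsupp.mapDomain_single]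

/-! ### Local factors, according to which of i and i + 1 the columns contain. -/

section Coefficients

variable {i N : ℕ} {C C' : Finset ℕ}

/-- The compatibility inequalities at i + 2 and i, written through membership of i and i + 1, reduce
each coefficient table to linear arithmetic. -/
theorem cnt_le_of_offCoeff (h : offCoeff i N C C' ≠ 0) :
    cnt (i + 2) C' ≤ cnt (i + 2) C ∧
      cnt (i + 2) C' + (if i + 1 ∈ C' then 1 else 0) + (if i ∈ C' then 1 else 0) ≤
        cnt (i + 2) C + (if i + 1 ∈ C then 1 else 0) + (if i ∈ C then 1 else 0) := by
  have := (offCoeff_eq_zero_or i N C C').resolve_left h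
  rwa [cnt_eq i C, cnt_eq i C', cnt_eq (i + 1) C, cnt_eq (i + 1) C'] at this

open Classical in
theorem colCoeff_eq_bits (hi : i + 1 < N) (C C' : Finset ℕ) :
    colCoeff N C C' = offCoeff i N C C' *
      if cnt (i + 2) C' + (if i + 1 ∈ C' then 1 else 0) ≤
          cnt (i + 2) C + (if i + 1 ∈ C then 1 else 0) then
        (if i ∈ C then X i else if cnt (i + 2) C' + (if i + 1 ∈ C' then 1 else 0) <
          cnt (i + 2) C + (if i + 1 ∈ C then 1 else 0) then 1 + betaVar * X i else 1) *
        (if i + 1 ∈ C then X (i + 1)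
          else if cnt (i + 2) C' < cnt (i + 2) C then 1 + betaVar * X (i + 1) else 1)
      else 0 := by
  rw [colCoeff_eq hi, cnt_eq (i + 1) C, cnt_eq (i + 1) C']

theorem sPoly_colCoeff (hi : i + 1 < N) (h1 : i ∉ C) (h2 : i + 1 ∉ C)
    (h : i ∈ C' ↔ i + 1 ∈ C') : sPoly i (colCoeff N C C') = colCoeff N C C' := by
  rw [colCoeff_eq_bits hi, map_mul, sPoly_offCoeff]
  by_cases h0 : offCoeff i N C C' = 0
  · simp [h0]
  have hm := cnt_le_of_offCoeff h0
  congr 1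
  simp only [h1, h2, h, if_false] at hm ⊢
  split_ifs at * <;> first
    | omega
    | simp only [map_mul, sPoly_one_add, sPoly_one_add_succ, map_one, mul_one, mul_comm]

theorem colCoeff_of_notMem (hi : i + 1 < N) (h1 : i ∉ C) (h2 : i + 1 ∉ C)
    (h1' : i ∈ C') (h2' : i + 1 ∉ C') :
    colCoeff N C C' =
        offCoeff i N C C' * ((1 + betaVar * X i) * (1 + betaVar * X (i + 1))) ∧
      (colCoeff N C (swapSet i C') =
          offCoeff i N C C' * ((1 + betaVar * X i) * (1 + betaVar * X (i + 1))) ∨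
        colCoeff N C (swapSet i C') = offCoeff i N C C' * (1 + betaVar * X (i + 1))) := by
  rw [colCoeff_eq_bits hi, colCoeff_eq_bits hi, offCoeff_swapSet_right,
    cnt_swapSet (by omega)]
  by_cases h0 : offCoeff i N C C' = 0
  · simp [h0]
  have hm := cnt_le_of_offCoeff h0
  simp only [right_mem_swapSet, h1, h2, h1', h2', if_false, if_true, add_zero] at hm ⊢
  rw [if_pos (by omega), if_pos (by omega), if_pos (by omega), if_pos (by omega)]
  refine ⟨rfl, ?_⟩
  split_ifs <;> simp

/-- The inequality at i + 1 follows from the one at i + 2, and neither i nor i + 1 is a replacement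
value, so the coefficient ignores which of them C' contains. -/
theorem colCoeff_of_mem (hi : i + 1 < N) (h1 : i ∈ C) (h2 : i + 1 ∈ C) :
    colCoeff N C C' = offCoeff i N C C' * (X i * X (i + 1)) := by
  rw [colCoeff_eq_bits hi]
  by_cases h0 : offCoeff i N C C' = 0
  · simp [h0]
  have hm := cnt_le_of_offCoeff h0
  simp only [h1, h2, if_true]
  rw [if_pos (by split_ifs <;> omega)]

theorem colCoeff_of_free_notMem (hi : i + 1 < N) (h1 : i ∈ C) (h2 : i + 1 ∉ C)
    (h1' : i ∉ C') (h2' : i + 1 ∉ C') :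
    (colCoeff N C C' = offCoeff i N C C' * (X i * (1 + betaVar * X (i + 1))) ∨
      colCoeff N C C' = offCoeff i N C C' * X i) ∧
    colCoeff N (swapSet i C) C' = offCoeff i N C C' * (X (i + 1) * (1 + betaVar * X i)) := by
  rw [colCoeff_eq_bits hi, colCoeff_eq_bits hi, offCoeff_swapSet_left,
    cnt_swapSet (by omega)]
  by_cases h0 : offCoeff i N C C' = 0
  · simp [h0]
  have hm := cnt_le_of_offCoeff h0
  simp only [left_mem_swapSet, right_mem_swapSet, h1, h2, h1', h2', if_false, if_true,
    add_zero] at hm ⊢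
  have a1 : cnt (i + 2) C' ≤ cnt (i + 2) C + 1 := by omega
  have a2 : cnt (i + 2) C' < cnt (i + 2) C + 1 := by omega
  simp only [hm.1, a1, a2, if_true, mul_comm (X (i + 1) : LRing), and_true]
  split_ifs <;> simp

theorem colCoeff_of_free_mem (hi : i + 1 < N) (h1 : i ∈ C) (h2 : i + 1 ∉ C)
    (h1' : i ∈ C') (h2' : i + 1 ∈ C') :
    colCoeff N C C' = offCoeff i N C C' * (X i * (1 + betaVar * X (i + 1))) ∧
    colCoeff N (swapSet i C) C' = offCoeff i N C C' * (X (i + 1) * (1 + betaVar * X i)) := by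
  rw [colCoeff_eq_bits hi, colCoeff_eq_bits hi, offCoeff_swapSet_left,
    cnt_swapSet (by omega)]
  by_cases h0 : offCoeff i N C C' = 0
  · simp [h0]
  have hm := cnt_le_of_offCoeff h0
  simp only [left_mem_swapSet, right_mem_swapSet, h1, h2, h1', h2', if_false, if_true,
    add_zero] at hm ⊢
  rw [if_pos (by omega), if_pos (by omega), if_pos (by omega), if_pos (by omega),
    mul_comm (X (i + 1))]
  exact ⟨rfl, rfl⟩

/-- The alternatives are strict inequality and equality of `cnt (i + 2)`. Under equality, C cannot
precede s_iC', whence the zero. -/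
theorem colCoeff_of_free_free (hi : i + 1 < N) (h1 : i ∈ C) (h2 : i + 1 ∉ C)
    (h1' : i ∈ C') (h2' : i + 1 ∉ C') :
    (colCoeff N C C' = offCoeff i N C C' * (X i * (1 + betaVar * X (i + 1))) ∧
      colCoeff N C (swapSet i C') = offCoeff i N C C' * (X i * (1 + betaVar * X (i + 1))) ∧
      colCoeff N (swapSet i C) C' = offCoeff i N C C' * (X (i + 1) * (1 + betaVar * X i)) ∧
      colCoeff N (swapSet i C) (swapSet i C') =
        offCoeff i N C C' * (X (i + 1) * (1 + betaVar * X i))) ∨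
    (colCoeff N C C' = offCoeff i N C C' * X i ∧
      colCoeff N C (swapSet i C') = 0 ∧
      colCoeff N (swapSet i C) C' = offCoeff i N C C' * (X (i + 1) * (1 + betaVar * X i)) ∧
      colCoeff N (swapSet i C) (swapSet i C') = offCoeff i N C C' * X (i + 1)) := by
  simp only [colCoeff_eq_bits hi, offCoeff_swapSet_left, offCoeff_swapSet_right,
    cnt_swapSet (show i + 2 ≠ i + 1 by omega)]
  by_cases h0 : offCoeff i N C C' = 0
  · simp [h0]
  have hm := cnt_le_of_offCoeff h0
  simp only [left_mem_swapSet, right_mem_swapSet, h1, h2, h1', h2', if_false, if_true,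
    add_zero] at hm ⊢
  rcases hm.1.lt_or_eq with h | h
  · left
    have a1 : cnt (i + 2) C' + 1 ≤ cnt (i + 2) C := h
    simp only [a1, h, hm.1, hm.1.trans (Nat.le_succ _), Nat.lt_succ_of_le hm.1,
      Nat.succ_le_succ hm.1, Nat.succ_lt_succ h, if_true, mul_comm (X (i + 1) : LRing)]
    simp
  · right
    simp [h, mul_comm (X (i + 1) : LRing)]

end Coefficients

/-! ### Adding one column on the left. -/

section Steps

variable {i N : ℕ} {C C' : Finset ℕ}

theorem add_barBeta_symm (g : LRing) : sPoly i (g + barBeta i g) = g + barBeta i g := by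
  rw [add_barBeta, sPoly_piBeta]

theorem sPoly_mul_of_symm {f g : LRing} (hf : sPoly i f = f) (hg : sPoly i g = g) :
    sPoly i (f * g) = f * g := by
  rw [map_mul, hf, hg]

theorem forall_keyCons_notMem (h1 : i ∉ C) (h2 : i + 1 ∉ C) (κ : List (Finset ℕ)) :
    ∀ D ∈ keyCons C κ, i ∉ D ∧ i + 1 ∉ D := fun _ hD =>
  ⟨fun h => h1 (subset_of_mem_keyCons hD h), fun h => h2 (subset_of_mem_keyCons hD h)⟩

/-- A column without i makes the new key forget s_i, so both terms land on one key with total g +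
(π_i − 1)g = π_i g, which is symmetric. -/
theorem addCol_mem_symmSums (hi : i + 1 < N) (h1 : i ∉ C) (h2 : i + 1 ∉ C)
    (h : i ∈ C' ↔ i + 1 ∈ C') {m : KeySum} (hm : m ∈ atomSums i) :
    addCol N C C' m ∈ symmSums i := by
  refine map_mem_of_closure _ ?_ hm
  rintro _ ⟨g, κ, hκ, rfl⟩
  rw [map_add, addCol_single, addCol_single, keyCons_swapKey h1, ← Finsupp.single_add, ← mul_add]
  exact single_mem_symmSums
    (sPoly_mul_of_symm (sPoly_colCoeff hi h1 h2 h) (add_barBeta_symm g))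
    (keyCons_chain C hκ.chain) (forall_keyCons_notMem h1 h2 κ)

theorem addCol_add_mem_symmSums (hi : i + 1 < N) (h1 : i ∉ C) (h2 : i + 1 ∉ C)
    (h1' : i ∈ C') (h2' : i + 1 ∉ C') {p : KeySum × KeySum} (hp : p ∈ atomPairs i) :
    addCol N C C' p.1 + addCol N C (swapSet i C') p.2 ∈ symmSums i := by
  refine map_mem_of_closure ((addCol N C C').coprod (addCol N C (swapSet i C'))) ?_ hp
  rintro _ ⟨g, κ, hκ, rfl⟩
  rw [LinearMap.coprod_apply, addCol_single, addCol_single, keyCons_swapKey h1,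
    ← Finsupp.single_add]
  refine single_mem_symmSums ?_ (keyCons_chain C hκ.chain) (forall_keyCons_notMem h1 h2 κ)
  obtain ⟨e1, e2 | e2⟩ := colCoeff_of_notMem hi h1 h2 h1' h2'
  · rw [e1, e2, mul_assoc, mul_assoc (offCoeff i N C C'), ← mul_add, ← mul_add]
    refine sPoly_mul_of_symm (sPoly_offCoeff i N C C')
      (sPoly_mul_of_symm ?_ (add_barBeta_symm g))
    rw [map_mul, sPoly_one_add, sPoly_one_add_succ, mul_comm]
  · rw [e1, e2, mul_assoc, mul_assoc (offCoeff i N C C'), ← mul_add]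
    exact sPoly_mul_of_symm (sPoly_offCoeff i N C C') (sPoly_mul_add_mul_barBeta i g)

theorem sPoly_colCoeff_of_mem (hi : i + 1 < N) (h1 : i ∈ C) (h2 : i + 1 ∈ C) :
    sPoly i (colCoeff N C C') = colCoeff N C C' := by
  rw [colCoeff_of_mem hi h1 h2]
  refine sPoly_mul_of_symm (sPoly_offCoeff i N C C') ?_
  rw [map_mul, sPoly_X_self, sPoly_X_succ, mul_comm]

theorem single_keyCons_mem_atomSums (hi : i + 1 < N) (h1 : i ∈ C) (h2 : i + 1 ∈ C) (g : LRing)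
    {κ : List (Finset ℕ)} (hκ : IsDominantKey i κ) :
    Finsupp.single (keyCons C κ) (colCoeff N C C' * g) +
      Finsupp.single (keyCons C (swapKey i κ)) (colCoeff N C C' * barBeta i g) ∈ atomSums i := by
  have hs := sPoly_colCoeff_of_mem (C' := C') hi h1 h2
  have hd := isDominantKey_keyCons_of_mem h1 hκ
  rcases keyCons_swapKey_or h1 h2 hκ with h | h
  · rw [h, ← Finsupp.single_add, ← mul_add]
    exact single_mem_atomSums (sPoly_mul_of_symm hs (add_barBeta_symm g)) hd
  · rw [h, ← barBeta_mul i hs]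
    exact single_add_single_mem_atomSums _ hd

theorem addCol_mem_atomSums (hi : i + 1 < N) (h1 : i ∈ C) (h2 : i + 1 ∈ C) {m : KeySum}
    (hm : m ∈ atomSums i) : addCol N C C' m ∈ atomSums i := by
  refine map_mem_of_closure _ ?_ hm
  rintro _ ⟨g, κ, hκ, rfl⟩
  rw [map_add, addCol_single, addCol_single]
  exact single_keyCons_mem_atomSums hi h1 h2 g hκ

theorem addCol_add_mem_atomSums (hi : i + 1 < N) (h1 : i ∈ C) (h2 : i + 1 ∈ C)
    {p : KeySum × KeySum} (hp : p ∈ atomPairs i) :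
    addCol N C C' p.1 + addCol N C (swapSet i C') p.2 ∈ atomSums i := by
  refine map_mem_of_closure ((addCol N C C').coprod (addCol N C (swapSet i C'))) ?_ hp
  rintro _ ⟨g, κ, hκ, rfl⟩
  have e : colCoeff N C (swapSet i C') = colCoeff N C C' := by
    rw [colCoeff_of_mem hi h1 h2, colCoeff_of_mem hi h1 h2, offCoeff_swapSet_right]
  rw [LinearMap.coprod_apply, addCol_single, addCol_single, e]
  exact single_keyCons_mem_atomSums hi h1 h2 g hκ

theorem keyCons_swapSet_swapKey (h1 : i ∈ C) (h2 : i + 1 ∉ C) {κ : List (Finset ℕ)}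
    (hκ : IsDominantKey i κ) :
    keyCons (swapSet i C) (swapKey i κ) = swapKey i (keyCons C κ) := by
  rw [keyCons_swapKey (by simpa using h2), keyCons_swapSet h1 h2 hκ]

/-- The g-term on κ is paired through `barBeta_X_mul_one_add`, which produces both terms of the
second component at once. The term on κ' has a symmetric coefficient, so its partner is zero. -/
theorem mk_mem_atomPairs_of_symm {w : LRing} (hw : sPoly i w = w) (g : LRing)
    {κ κ' : List (Finset ℕ)} (hκ : IsDominantKey i κ) (hκ' : IsDominantKey i κ') :
    (Finsupp.single κ (w * (X i * (1 + betaVar * X (i + 1))) * g) +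
        Finsupp.single κ' (w * (X i * (1 + betaVar * X (i + 1))) * barBeta i g),
      Finsupp.single (swapKey i κ) (w * (X (i + 1) * (1 + betaVar * X i)) * g) +
        Finsupp.single (swapKey i κ) (w * (X (i + 1) * (1 + betaVar * X i)) * barBeta i g)) ∈
      atomPairs i := by
  rw [← Finsupp.single_add, ← mul_add, add_barBeta, mul_assoc, mul_assoc w, mul_assoc w]
  have e1 := mk_mem_atomPairs (w * (X i * (1 + betaVar * X (i + 1)) * g)) hκ
  rw [barBeta_mul i hw, barBeta_X_mul_one_add] at e1
  have e2 := mk_zero_mem_atomPairs (sPoly_mul_of_symm hw (sPoly_X_mul_barBeta i g)) hκ'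
  simpa using add_mem e1 e2

theorem addCol_prod_mem_of_symmSums (hi : i + 1 < N) (h1 : i ∈ C) (h2 : i + 1 ∉ C)
    (h1' : i ∉ C') (h2' : i + 1 ∉ C') {m : KeySum} (hm : m ∈ symmSums i) :
    (addCol N C C' m, addCol N (swapSet i C) C' m) ∈ atomPairs i := by
  refine map_mem_of_closure ((addCol N C C').prod (addCol N (swapSet i C) C')) ?_ hm
  rintro _ ⟨g, κ, hg, hκ, h, rfl⟩
  have hd : IsDominantKey i κ := ⟨hκ, fun D hD hi => absurd hi (h D hD).2⟩
  rw [LinearMap.prod_apply, Function.prod_apply, addCol_single, addCol_single, keyCons_swapSet h1 h2 hd]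
  have hw := sPoly_offCoeff i N C C'
  have hd' := isDominantKey_keyCons_of_notMem h2 hκ
  obtain ⟨e1 | e1, e2⟩ := colCoeff_of_free_notMem hi h1 h2 h1' h2'
  · have := mk_mem_atomPairs_of_symm hw g hd' hd'
    rw [barBeta_of_symm i hg] at this
    simpa [e1, e2] using this
  · have := mk_mem_atomPairs (offCoeff i N C C' * (X i * g)) hd'
    rw [barBeta_mul i hw, barBeta_X_mul, barBeta_of_symm i hg, add_zero] at this
    rw [e1, e2]
    simpa only [mul_assoc] using this

theorem addCol_prod_mem_of_atomSums (hi : i + 1 < N) (h1 : i ∈ C) (h2 : i + 1 ∉ C)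
    (h1' : i ∈ C') (h2' : i + 1 ∈ C') {m : KeySum} (hm : m ∈ atomSums i) :
    (addCol N C C' m, addCol N (swapSet i C) C' m) ∈ atomPairs i := by
  refine map_mem_of_closure ((addCol N C C').prod (addCol N (swapSet i C) C')) ?_ hm
  rintro _ ⟨g, κ, hκ, rfl⟩
  obtain ⟨e1, e2⟩ := colCoeff_of_free_mem hi h1 h2 h1' h2'
  rw [LinearMap.prod_apply, Function.prod_apply, map_add, map_add, addCol_single, addCol_single,
    addCol_single, addCol_single, keyCons_swapSet h1 h2 hκ, keyCons_swapSet_swapKey h1 h2 hκ,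
    e1, e2]
  exact mk_mem_atomPairs_of_symm (sPoly_offCoeff i N C C') g
    (isDominantKey_keyCons_of_notMem h2 hκ.chain)
    (isDominantKey_keyCons_of_notMem h2 (swapKey_chain i hκ.chain))

theorem addCol_prod_mem_of_atomPairs (hi : i + 1 < N) (h1 : i ∈ C) (h2 : i + 1 ∉ C)
    (h1' : i ∈ C') (h2' : i + 1 ∉ C') {p : KeySum × KeySum} (hp : p ∈ atomPairs i) :
    (addCol N C C' p.1 + addCol N C (swapSet i C') p.2,
      addCol N (swapSet i C) C' p.1 + addCol N (swapSet i C) (swapSet i C') p.2) ∈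
      atomPairs i := by
  refine map_mem_of_closure (((addCol N C C').coprod (addCol N C (swapSet i C'))).prod
    ((addCol N (swapSet i C) C').coprod (addCol N (swapSet i C) (swapSet i C')))) ?_ hp
  rintro _ ⟨g, κ, hκ, rfl⟩
  rw [LinearMap.prod_apply, Function.prod_apply, LinearMap.coprod_apply, LinearMap.coprod_apply, addCol_single,
    addCol_single, addCol_single, addCol_single, keyCons_swapSet h1 h2 hκ,
    keyCons_swapSet_swapKey h1 h2 hκ]
  have hw := sPoly_offCoeff i N C C'
  have hd := isDominantKey_keyCons_of_notMem h2 hκ.chain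
  rcases colCoeff_of_free_free hi h1 h2 h1' h2' with ⟨e1, e2, e3, e4⟩ | ⟨e1, e2, e3, e4⟩
  · rw [e1, e2, e3, e4]
    exact mk_mem_atomPairs_of_symm hw g hd
      (isDominantKey_keyCons_of_notMem h2 (swapKey_chain i hκ.chain))
  -- In the equality case the two contributions to s_iC combine into the right side of
  -- `barBeta_X_mul`.
  · have := mk_mem_atomPairs (offCoeff i N C C' * (X i * g)) hd
    rw [barBeta_mul i hw, barBeta_X_mul] at this
    rw [e1, e2, e3, e4, zero_mul, Finsupp.single_zero, add_zero, ← Finsupp.single_add]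
    convert this using 3
    · ring
    · rfl
    · ring

end Steps

/-! ### The generating function by keys. -/

open Classical in
/-- The generating function by keys of the tableaux with given column lengths, given first
column, and entries smaller than `N`. -/
def colSum (N : ℕ) : List ℕ → Finset ℕ → KeySum
  -- An empty column after the last one lets `addCol` treat the last column like the others.
  | [], C => if C = ∅ then Finsupp.single [] 1 else 0
  | h :: hs, C =>
    if C.card = h then ∑ C' ∈ (Finset.range N).powerset, addCol N C C' (colSum N hs C') else 0

/-- Sets containing both or neither of i and i + 1 are fixed by s_i; the others are summed in orbits
{C, s_iC}, represented by the C containing i. -/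
theorem sum_powerset_mem {A : Type*} [AddCommMonoid A] (T : AddSubmonoid A) {i N : ℕ}
    (hi : i + 1 < N) (F : Finset ℕ → A)
    (h0 : ∀ C, i ∉ C → i + 1 ∉ C → F C ∈ T) (h2 : ∀ C, i ∈ C → i + 1 ∈ C → F C ∈ T)
    (h1 : ∀ C, i ∈ C → i + 1 ∉ C → F C + F (swapSet i C) ∈ T) :
    ∑ C ∈ (Finset.range N).powerset, F C ∈ T := by
  classical
  rw [← Finset.sum_filter_add_sum_filter_not _ (fun C => i ∈ C ↔ i + 1 ∈ C)]
  refine add_mem (sum_mem fun C hC => ?_) ?_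
  · have h := (Finset.mem_filter.1 hC).2
    by_cases hi : i ∈ C
    · exact h2 C hi (h.1 hi)
    · exact h0 C hi fun h' => hi (h.2 h')
  · rw [← Finset.sum_filter_add_sum_filter_not _ (fun C => i ∈ C)]
    have e : ∑ C ∈ (((Finset.range N).powerset.filter fun C => ¬ (i ∈ C ↔ i + 1 ∈ C)).filter
          fun C => ¬ i ∈ C), F C =
        ∑ C ∈ (((Finset.range N).powerset.filter fun C => ¬ (i ∈ C ↔ i + 1 ∈ C)).filter
          fun C => i ∈ C), F (swapSet i C) := by
      refine Finset.sum_nbij' (swapSet i) (swapSet i) ?_ ?_ ?_ ?_ ?_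
      · intro C hC
        simp only [Finset.mem_filter, Finset.mem_powerset, swapSet_subset_range hi,
          left_mem_swapSet, right_mem_swapSet] at hC ⊢
        tauto
      · intro C hC
        simp only [Finset.mem_filter, Finset.mem_powerset, swapSet_subset_range hi,
          left_mem_swapSet, right_mem_swapSet] at hC ⊢
        tauto
      · simp
      · simp
      · simp
    rw [e, ← Finset.sum_add_distrib]
    refine sum_mem fun C hC => ?_
    simp only [Finset.mem_filter] at hC
    exact h1 C hC.2 (by tauto)

/-- The three cases are proved together because the second column may be of any type, whatever the
type of the first. -/
theorem colSum_mem {i N : ℕ} (hi : i + 1 < N) (hs : List ℕ) :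
    (∀ C, i ∉ C → i + 1 ∉ C → colSum N hs C ∈ symmSums i) ∧
    (∀ C, i ∈ C → i + 1 ∈ C → colSum N hs C ∈ atomSums i) ∧
    (∀ C, i ∈ C → i + 1 ∉ C → (colSum N hs C, colSum N hs (swapSet i C)) ∈ atomPairs i) := by
  induction hs with
  | nil =>
    refine ⟨fun C _ _ => ?_, fun C h1 _ => ?_, fun C h1 _ => ?_⟩
    · rw [colSum]
      split_ifs
      · exact single_mem_symmSums (map_one _) List.Pairwise.nil (by simp)
      · exact zero_mem _
    · rw [colSum, if_neg (Finset.ne_empty_of_mem h1)]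
      exact zero_mem _
    · rw [colSum, colSum, if_neg (Finset.ne_empty_of_mem h1),
        if_neg (Finset.ne_empty_of_mem (right_mem_swapSet.2 h1))]
      exact zero_mem _
  | cons h hs ih =>
    obtain ⟨ih0, ih2, ih1⟩ := ih
    refine ⟨fun C c1 c2 => ?_, fun C c1 c2 => ?_, fun C c1 c2 => ?_⟩
    · rw [colSum]
      split_ifs
      · refine sum_powerset_mem _ hi _ (fun C' d1 d2 => ?_) (fun C' d1 d2 => ?_)
          (fun C' d1 d2 => ?_)
        · exact addCol_mem_symmSums hi c1 c2 (iff_of_false d1 d2)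
            (symmSums_le_atomSums i (ih0 C' d1 d2))
        · exact addCol_mem_symmSums hi c1 c2 (iff_of_true d1 d2) (ih2 C' d1 d2)
        · have := addCol_add_mem_symmSums hi c1 c2 d1 d2 (ih1 C' d1 d2)
          exact this
      · exact zero_mem _
    · rw [colSum]
      split_ifs
      · refine sum_powerset_mem _ hi _ (fun C' d1 d2 => ?_) (fun C' d1 d2 => ?_)
          (fun C' d1 d2 => ?_)
        · exact addCol_mem_atomSums hi c1 c2 (symmSums_le_atomSums i (ih0 C' d1 d2))
        · exact addCol_mem_atomSums hi c1 c2 (ih2 C' d1 d2)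
        · have := addCol_add_mem_atomSums (N := N) (C' := C') hi c1 c2 (ih1 C' d1 d2)
          exact this
      · exact zero_mem _
    · rw [colSum, colSum, card_swapSet]
      split_ifs
      · rw [prod_mk_sum]
        refine sum_powerset_mem _ hi _ (fun C' d1 d2 => ?_) (fun C' d1 d2 => ?_)
          (fun C' d1 d2 => ?_)
        · have := addCol_prod_mem_of_symmSums hi c1 c2 d1 d2 (ih0 C' d1 d2)
          exact this
        · have := addCol_prod_mem_of_atomSums hi c1 c2 d1 d2 (ih2 C' d1 d2)
          exact this
        · have := addCol_prod_mem_of_atomPairs hi c1 c2 d1 d2 (ih1 C' d1 d2)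
          exact this
      · exact zero_mem _

theorem sum_colSum_mem {i N : ℕ} (hi : i + 1 < N) (hs : List ℕ) :
    ∑ C ∈ (Finset.range N).powerset, colSum N hs C ∈ atomSums i := by
  obtain ⟨h0, h2, h1⟩ := colSum_mem hi hs
  refine sum_powerset_mem _ hi (colSum N hs)
    (fun C d1 d2 => symmSums_le_atomSums i (h0 C d1 d2)) h2 fun C d1 d2 => ?_
  have := add_mem_atomSums (h1 C d1 d2)
  exact this

/-! ### Restriction to keys below α. -/

/-- The composition counting, for each `j`, the columns of a key that contain `j`. -/
def keyContent (κ : List (Finset ℕ)) : Comp :=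
  (κ.map fun D => ∑ j ∈ D, Finsupp.single j 1).sum

theorem sum_single_apply (D : Finset ℕ) (j : ℕ) :
    (∑ k ∈ D, Finsupp.single k 1 : Comp) j = if j ∈ D then 1 else 0 := by
  rw [Finsupp.finsetSum_apply]
  simp [Finsupp.single_apply]

theorem keyContent_apply (κ : List (Finset ℕ)) (j : ℕ) :
    keyContent κ j = (κ.map fun D => if j ∈ D then 1 else 0).sum := by
  induction κ with
  | nil => rfl
  | cons D κ ih =>
    rw [List.map_cons, List.sum_cons, ← ih, keyContent, List.map_cons, List.sum_cons,
      Finsupp.add_apply, sum_single_apply, keyContent]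

theorem keyContent_swapKey (i : ℕ) (κ : List (Finset ℕ)) :
    keyContent (swapKey i κ) = swapComp i (i + 1) (keyContent κ) := by
  ext j
  rw [swapComp_apply, keyContent_apply, keyContent_apply, swapKey, List.map_map]
  simp only [Function.comp_def, mem_swapSet]

theorem keyContent_le_of_isDominantKey {i : ℕ} {κ : List (Finset ℕ)} (h : IsDominantKey i κ) :
    keyContent κ (i + 1) ≤ keyContent κ i := by
  rw [keyContent_apply, keyContent_apply]
  refine List.sum_le_sum fun D hD => ?_
  have := h.dominant D hD
  split_ifs <;> first | omega | tauto

open Classical in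
/-- The sum of the coefficients of the keys that are at most `α` in Bruhat order. -/
def evalBelow (α : Comp) : KeySum →+ LRing :=
  Finsupp.liftAddHom fun κ =>
    if BruhatLE (keyContent κ) α then AddMonoidHom.id LRing else 0

open Classical in
theorem evalBelow_single (α : Comp) (κ : List (Finset ℕ)) (g : LRing) :
    evalBelow α (Finsupp.single κ g) = if BruhatLE (keyContent κ) α then g else 0 := by
  rw [evalBelow, Finsupp.liftAddHom_apply_single]
  split_ifs <;> rfl

open Classical in
-- It suffices to treat one generator. If κ ≤ α, then dominance gives κ ≤ s_iα, so g is counted on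
-- the left; whether s_iκ is counted too is irrelevant, since π_i kills (π_i − 1)g.
theorem piBeta_evalBelow {i : ℕ} {α : Comp} (hα : α i < α (i + 1)) {m : KeySum}
    (hm : m ∈ atomSums i) :
    piBeta i (evalBelow (swapComp i (i + 1) α) m) = evalBelow α m := by
  have hle : BruhatLE (swapComp i (i + 1) α) α := by
    have := bruhatLE_swapComp (γ := swapComp i (i + 1) α) (Nat.lt_succ_self i)
      (by simpa [swapComp_apply] using hα)
    rwa [swapComp_swapComp] at this
  induction hm using AddSubmonoid.closure_induction with
  | zero => simp [piBeta_zero]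
  | add x y _ _ hx hy => rw [map_add, map_add, piBeta_add, hx, hy]
  | mem x hx =>
    obtain ⟨g, κ, hκ, rfl⟩ := hx
    have hs : BruhatLE (swapComp i (i + 1) (keyContent κ)) α ↔ BruhatLE (keyContent κ) α :=
      ⟨fun h => by simpa [swapComp_swapComp] using swapComp_le_of_le hα h, swapComp_le_of_le hα⟩
    simp only [map_add, evalBelow_single, keyContent_swapKey, hs]
    by_cases h : BruhatLE (keyContent κ) α
    · have h' := le_swapComp_of_le hα (keyContent_le_of_isDominantKey hκ) h
      rw [if_pos h, if_pos h', if_pos h, piBeta_add, add_barBeta]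
      split_ifs
      · rw [piBeta_barBeta, add_zero]
      · rw [piBeta_zero, add_zero]
    · rw [if_neg h, if_neg fun h' => h (h'.trans hle), if_neg h,
        if_neg fun h' => h (hs.1 (h'.trans hle)), add_zero, piBeta_zero]

/-! ### Expansion of the generating function over lists of columns. -/

open Classical in
/-- The tableaux with given column lengths and entries smaller than `N`, as lists of columns. -/
def tableauLists (N : ℕ) : List ℕ → Finset (List (Finset ℕ))
  | [] => {[]}
  | h :: hs => (((Finset.range N).powerset ×ˢ tableauLists N hs).filter
      fun p => p.1.card = h ∧ Dominates p.1 (p.2.headD ∅)).image fun p => p.1 :: p.2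

/-- The weight of a tableau given as a list of columns. -/
def listWeight (N : ℕ) : List (Finset ℕ) → LRing
  | [] => 1
  | C :: L => colWeight N C (L.headD ∅) * listWeight N L

/-- The columns of the left key of a tableau given as a list of columns. -/
def keyList : List (Finset ℕ) → List (Finset ℕ)
  | [] => []
  | C :: L => keyCons C (keyList L)

theorem cons_mem_tableauLists {N h : ℕ} {hs : List ℕ} {C : Finset ℕ} {L : List (Finset ℕ)} :
    C :: L ∈ tableauLists N (h :: hs) ↔ C ⊆ Finset.range N ∧ C.card = h ∧
      Dominates C (L.headD ∅) ∧ L ∈ tableauLists N hs := by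
  simp only [tableauLists, Finset.mem_image, Finset.mem_filter, Finset.mem_product,
    Finset.mem_powerset, Prod.exists, List.cons.injEq]
  constructor
  · rintro ⟨C, L, ⟨⟨h1, h2⟩, h3, h4⟩, rfl, rfl⟩
    exact ⟨h1, h3, h4, h2⟩
  · rintro ⟨h1, h3, h4, h2⟩
    exact ⟨C, L, ⟨⟨h1, h2⟩, h3, h4⟩, rfl, rfl⟩

theorem exists_of_mem_tableauLists_cons {N h : ℕ} {hs : List ℕ} {L : List (Finset ℕ)}
    (hL : L ∈ tableauLists N (h :: hs)) : ∃ C L', L = C :: L' := by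
  simp only [tableauLists, Finset.mem_image] at hL
  obtain ⟨p, -, rfl⟩ := hL
  exact ⟨_, _, rfl⟩

theorem headD_subset_of_mem {N : ℕ} {hs : List ℕ} {L : List (Finset ℕ)}
    (hL : L ∈ tableauLists N hs) : L.headD ∅ ⊆ Finset.range N := by
  cases hs with
  | nil =>
    rw [tableauLists, Finset.mem_singleton] at hL
    simp [hL]
  | cons h hs =>
    obtain ⟨C, L, rfl⟩ := exists_of_mem_tableauLists_cons hL
    exact (cons_mem_tableauLists.1 hL).1

open Classical in
theorem colSum_eq (N : ℕ) (hs : List ℕ) {C : Finset ℕ} (hC : C ⊆ Finset.range N) :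
    colSum N hs C = ∑ L ∈ tableauLists N hs,
      if L.headD ∅ = C then Finsupp.single (keyList L) (listWeight N L) else 0 := by
  induction hs generalizing C with
  | nil =>
    rw [colSum, tableauLists, Finset.sum_singleton]
    by_cases h : C = ∅
    · simp [h, keyList, listWeight]
    · simp [h, Ne.symm h]
  | cons h hs ih =>
    have rhs : (∑ L ∈ tableauLists N (h :: hs),
        if L.headD ∅ = C then Finsupp.single (keyList L) (listWeight N L) else 0) =
        ∑ L ∈ tableauLists N hs, if C.card = h ∧ Dominates C (L.headD ∅) then
          Finsupp.single (keyCons C (keyList L)) (colWeight N C (L.headD ∅) * listWeight N L)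
          else 0 := by
      rw [tableauLists, Finset.sum_image (fun p _ q _ e => by simpa [Prod.ext_iff] using e),
        Finset.sum_filter, Finset.sum_product, Finset.sum_eq_single C]
      · exact Finset.sum_congr rfl fun L _ => by simp [keyList, listWeight]
      · intro D _ hDC
        refine Finset.sum_eq_zero fun L _ => ?_
        simp [hDC]
      · exact fun h => absurd (Finset.mem_powerset.2 hC) h
    rw [rhs, colSum]
    split_ifs with hcard
    · have e : ∀ C' ∈ (Finset.range N).powerset, addCol N C C' (colSum N hs C') =
          ∑ L ∈ tableauLists N hs, if L.headD ∅ = C' then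
            Finsupp.single (keyCons C (keyList L)) (colCoeff N C C' * listWeight N L)
            else 0 := by
        intro C' hC'
        rw [ih (Finset.mem_powerset.1 hC'), map_sum]
        refine Finset.sum_congr rfl fun L _ => ?_
        rw [apply_ite (addCol N C C'), addCol_single, map_zero]
      rw [Finset.sum_congr rfl e, Finset.sum_comm]
      refine Finset.sum_congr rfl fun L hL => ?_
      rw [Finset.sum_ite_eq, if_pos (Finset.mem_powerset.2 (headD_subset_of_mem hL)), colCoeff]
      by_cases hd : Dominates C (L.headD ∅)
      · rw [if_pos hd, if_pos ⟨hcard, hd⟩]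
      · rw [if_neg hd, if_neg fun h => hd h.2, zero_mul, Finsupp.single_zero]
    · symm
      exact Finset.sum_eq_zero fun L _ => if_neg fun h => hcard h.1

open Classical in
theorem evalBelow_sum_colSum (N : ℕ) (hs : List ℕ) (α : Comp) :
    evalBelow α (∑ C ∈ (Finset.range N).powerset, colSum N hs C) =
      ∑ L ∈ (tableauLists N hs).filter fun L => BruhatLE (keyContent (keyList L)) α,
        listWeight N L := by
  rw [Finset.sum_congr rfl fun C hC => colSum_eq N hs (Finset.mem_powerset.1 hC),
    Finset.sum_comm, map_sum, Finset.sum_filter]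
  refine Finset.sum_congr rfl fun L hL => ?_
  rw [Finset.sum_ite_eq, if_pos (Finset.mem_powerset.2 (headD_subset_of_mem hL)),
    evalBelow_single]

/-! ### The unique tableau for a partition. -/

theorem subset_of_mem_keyList {L : List (Finset ℕ)} {D : Finset ℕ} (h : D ∈ keyList L) :
    D ⊆ L.headD ∅ := by
  cases L with
  | nil => simp [keyList] at h
  | cons C L => exact subset_of_mem_keyCons h

theorem cnt_range (n t : ℕ) : cnt t (Finset.range n) = n - t := by
  have : (Finset.range n).filter (t ≤ ·) = Finset.Ico t n := by
    ext s
    simp [and_comm]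
  rw [cnt, this, Nat.card_Ico]

theorem lt_of_cnt_eq_zero {t a : ℕ} {C : Finset ℕ} (h : cnt t C = 0) (ha : a ∈ C) : a < t := by
  by_contra hlt
  exact Finset.notMem_empty a
    (Finset.card_eq_zero.1 h ▸ Finset.mem_filter.2 ⟨ha, not_lt.1 hlt⟩)

theorem subset_range_of_dominates {C C' : Finset ℕ} {n : ℕ} (h : Dominates C C')
    (hC : C ⊆ Finset.range n) : C' ⊆ Finset.range n := by
  have h0 : cnt n C = 0 := Finset.card_eq_zero.2 (Finset.filter_eq_empty_iff.2 fun a ha =>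
    not_le.2 (Finset.mem_range.1 (hC ha)))
  intro a ha
  exact Finset.mem_range.2 (lt_of_cnt_eq_zero (Nat.le_zero.1 (h0 ▸ h n)) ha)

theorem keyList_cons_range {n : ℕ} {L : List (Finset ℕ)}
    (h : Dominates (Finset.range n) (L.headD ∅)) :
    keyList (Finset.range n :: L) = Finset.range n :: keyList L := by
  rw [keyList, keyCons]
  congr 1
  refine (List.map_congr_left fun D hD => tri_range ?_).trans (List.map_id _)
  exact (subset_of_mem_keyList hD).trans (subset_range_of_dominates h (Finset.Subset.refl _))

/-- A tableau and its key share the first column. The content confines it to `range n`, and its size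
makes it equal. By `tri_range` it leaves the rest of the key unchanged, so its content cancels. -/
theorem eq_map_range_of_keyContent {N : ℕ} {hs : List ℕ} (hsort : hs.Pairwise (· ≥ ·))
    {L : List (Finset ℕ)} (hL : L ∈ tableauLists N hs)
    (h : keyContent (keyList L) = keyContent (hs.map Finset.range)) :
    L = hs.map Finset.range := by
  induction hs generalizing L with
  | nil => simpa [tableauLists] using hL
  | cons n hs ih =>
    obtain ⟨C, L, rfl⟩ := exists_of_mem_tableauLists_cons hL
    obtain ⟨-, hcard, hdom, hL'⟩ := cons_mem_tableauLists.1 hL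
    obtain ⟨hn, hsort⟩ := List.pairwise_cons.1 hsort
    have hCn : C ⊆ Finset.range n := by
      intro j hj
      rw [Finset.mem_range]
      by_contra hjn
      have h1 := DFunLike.congr_fun h j
      rw [keyContent_apply, keyContent_apply, keyList, keyCons, List.map_cons, List.sum_cons,
        if_pos hj,
        List.sum_eq_zero (l := List.map _ (List.map Finset.range (n :: hs)))] at h1
      · omega
      · intro x hx
        rw [List.map_map] at hx
        obtain ⟨k, hk, rfl⟩ := List.mem_map.1 hx
        have : ¬ j < k := by
          rcases List.mem_cons.1 hk with rfl | hk
          · exact hjn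
          · have := hn k hk
            omega
        simp [this]
    have hC : C = Finset.range n :=
      Finset.eq_of_subset_of_card_le hCn (by rw [hcard, Finset.card_range])
    subst hC
    rw [keyList_cons_range hdom] at h
    simp only [keyContent, List.map_cons, List.sum_cons, add_right_inj] at h
    rw [List.map_cons, ← ih hsort hL' h]

theorem dominates_range {n : ℕ} {hs : List ℕ} (h : ∀ k ∈ hs, k ≤ n) :
    Dominates (Finset.range n) ((hs.map Finset.range).headD ∅) := by
  intro t
  cases hs with
  | nil => simp [cnt]
  | cons k hs =>
    have := h k List.mem_cons_self
    simp only [List.map_cons, List.headD_cons, cnt_range]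
    omega

theorem map_range_mem_tableauLists {N : ℕ} {hs : List ℕ} (hsort : hs.Pairwise (· ≥ ·))
    (hN : ∀ k ∈ hs, k ≤ N) :
    hs.map Finset.range ∈ tableauLists N hs ∧
      keyList (hs.map Finset.range) = hs.map Finset.range ∧
      listWeight N (hs.map Finset.range) = xpow (keyContent (hs.map Finset.range)) := by
  induction hs with
  | nil => simp [tableauLists, keyList, listWeight, keyContent, xpow]
  | cons n hs ih =>
    obtain ⟨hn, hsort⟩ := List.pairwise_cons.1 hsort
    obtain ⟨ih1, ih2, ih3⟩ := ih hsort fun k hk => hN k (List.mem_cons_of_mem _ hk)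
    have hd := dominates_range hn
    have hnN := hN n List.mem_cons_self
    refine ⟨?_, ?_, ?_⟩
    · rw [List.map_cons, cons_mem_tableauLists]
      exact ⟨Finset.range_subset_range.2 hnN, Finset.card_range n, hd, ih1⟩
    · rw [List.map_cons, keyList_cons_range hd, ih2]
    · rw [List.map_cons, listWeight, ih3, colWeight, Finset.filter_false_of_mem]
      · simp only [Finset.prod_empty, mul_one, keyContent, List.map_cons, List.sum_cons, xpow]
        rw [← one_mul (1 : Polynomial ℤ), ← monomial_mul, one_mul, monomial_sum_one]
        rfl
      -- A value outside `range n` exceeds all entries of the column, so it replaces none.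
      · intro k _ h
        rw [Finset.mem_range, cnt_range] at h
        omega

/-! ### Columns of a tableau and replaceable entries. -/

/-- In a strictly decreasing column the entries ≥ t fill an initial segment of rows, which turns
comparisons of entries into comparisons of counts. -/
theorem le_iff_lt_cnt_image {f : ℕ → ℕ} {n : ℕ}
    (hf : ∀ r₁ r₂, r₁ < r₂ → r₂ < n → f r₂ < f r₁) {r : ℕ} (hr : r < n) (t : ℕ) :
    t ≤ f r ↔ r < cnt t ((Finset.range n).image f) := by
  have hinj : Set.InjOn f ↑((Finset.range n).filter fun s => t ≤ f s) := by
    intro a ha b hb hab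
    simp only [Finset.coe_filter, Finset.mem_range, Set.mem_ofPred_eq] at ha hb
    rcases lt_trichotomy a b with h | h | h
    · exact absurd hab (hf a b h hb.1).ne'
    · exact h
    · exact absurd hab (hf b a h ha.1).ne
  rw [cnt, Finset.filter_image, Finset.card_image_of_injOn hinj]
  constructor
  · intro h
    rw [← Nat.succ_le_iff, ← Finset.card_range r.succ]
    refine Finset.card_le_card fun s hs => ?_
    have hsr : s ≤ r := Nat.lt_succ_iff.1 (Finset.mem_range.1 hs)
    refine Finset.mem_filter.2 ⟨Finset.mem_range.2 (hsr.trans_lt hr), ?_⟩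
    rcases hsr.eq_or_lt with rfl | hsr
    · exact h
    · exact h.trans (hf s r hsr hr).le
  · intro h
    by_contra hlt
    refine absurd h (not_lt.2 ?_)
    rw [← Finset.card_range r]
    refine Finset.card_le_card fun s hs => ?_
    obtain ⟨hs, hts⟩ := Finset.mem_filter.1 hs
    rw [Finset.mem_range] at hs ⊢
    by_contra hrs
    rcases (not_lt.1 hrs).eq_or_lt with rfl | h'
    · exact hlt hts
    · exact hlt (hts.trans (hf r s h' hs).le)

theorem cnt_le_card (t : ℕ) (C : Finset ℕ) : cnt t C ≤ C.card := Finset.card_filter_le _ _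

theorem exists_strictAnti_image (C : Finset ℕ) : ∃ f : ℕ → ℕ,
    (∀ r₁ r₂, r₁ < r₂ → r₂ < C.card → f r₂ < f r₁) ∧ (Finset.range C.card).image f = C := by
  have hlt : ∀ r, r < C.card → C.card - 1 - r < C.card := fun r hr => by omega
  let e := C.orderEmbOfFin rfl
  let f : ℕ → ℕ := fun r => if h : r < C.card then e ⟨C.card - 1 - r, hlt r h⟩ else 0
  have hf : ∀ r (h : r < C.card), f r = e ⟨C.card - 1 - r, hlt r h⟩ := fun r h => dif_pos h
  refine ⟨f, fun r₁ r₂ h h2 => ?_, ?_⟩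
  · rw [hf r₂ h2, hf r₁ (h.trans h2)]
    refine e.strictMono ?_
    rw [Fin.mk_lt_mk]
    omega
  · ext a
    simp only [Finset.mem_image, Finset.mem_range]
    constructor
    · rintro ⟨r, hr, rfl⟩
      rw [hf r hr]
      exact C.orderEmbOfFin_mem rfl _
    · intro ha
      have : a ∈ Set.range e := by
        rw [Finset.range_orderEmbOfFin]
        exact ha
      obtain ⟨s, rfl⟩ := this
      refine ⟨C.card - 1 - s, by omega, ?_⟩
      rw [hf _ (by omega)]
      congr 1
      ext
      simp only
      omega

theorem colLen_eq_zero {μ : YoungDiagram} {c : ℕ} (hc : μ.rowLen 0 ≤ c) : μ.colLen c = 0 := by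
  by_contra h
  have := YoungDiagram.mem_iff_lt_rowLen.1
    (YoungDiagram.mem_iff_lt_colLen.2 (Nat.pos_of_ne_zero h))
  omega

theorem lt_rowLen_zero_of_mem {μ : YoungDiagram} {r c : ℕ} (h : (r, c) ∈ μ) :
    c < μ.rowLen 0 :=
  YoungDiagram.mem_iff_lt_rowLen.1 (μ.up_left_mem (Nat.zero_le r) le_rfl h)

theorem column_eq_empty {μ : YoungDiagram} {c : ℕ} (hc : μ.rowLen 0 ≤ c) (T : ℕ × ℕ → ℕ) :
    column μ T c = ∅ := by
  rw [column, colLen_eq_zero hc, Finset.range_zero, Finset.image_empty]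

section Tableau

variable {μ : YoungDiagram} {T : ℕ × ℕ → ℕ} (hT : IsRSSYT μ T)
include hT

theorem le_iff_lt_cnt_column {r c : ℕ} (hr : r < μ.colLen c) (t : ℕ) :
    t ≤ T (r, c) ↔ r < cnt t (column μ T c) :=
  le_iff_lt_cnt_image (f := fun r => T (r, c))
    (fun r₁ r₂ h h2 => hT.col_strict r₁ r₂ c h (YoungDiagram.mem_iff_lt_colLen.2 h2)) hr t

theorem card_column (c : ℕ) : (column μ T c).card = μ.colLen c := by
  rw [column, Finset.card_image_of_injOn, Finset.card_range]
  intro a ha b hb hab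
  simp only [Finset.coe_range, Set.mem_Iio] at ha hb
  rcases lt_trichotomy a b with h | h | h
  · exact absurd hab (hT.col_strict a b c h (YoungDiagram.mem_iff_lt_colLen.2 hb)).ne'
  · exact h
  · exact absurd hab (hT.col_strict b a c h (YoungDiagram.mem_iff_lt_colLen.2 ha)).ne

theorem dominates_column {c c' : ℕ} (h : c < c') :
    Dominates (column μ T c) (column μ T c') := by
  intro t
  by_contra hlt
  push Not at hlt
  have h1 : cnt t (column μ T c) < μ.colLen c' :=
    hlt.trans_le ((cnt_le_card _ _).trans (card_column hT _).le)
  have h2 := (le_iff_lt_cnt_column hT h1 t).2 hlt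
  have h3 := hT.row_weak _ _ _ h (YoungDiagram.mem_iff_lt_colLen.2 h1)
  exact lt_irrefl _ ((le_iff_lt_cnt_column hT (h1.trans_le (μ.colLen_anti _ _ h.le)) t).1
    (h2.trans h3))

theorem isRSSYT_update_iff {r c k : ℕ} (hrc : (r, c) ∈ μ) (hk : k < T (r, c)) :
    IsRSSYT μ (Function.update T (r, c) k) ↔
      ((r, c + 1) ∈ μ → T (r, c + 1) ≤ k) ∧ ((r + 1, c) ∈ μ → T (r + 1, c) < k) := by
  constructor
  · intro h
    refine ⟨fun h1 => ?_, fun h1 => ?_⟩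
    · have := h.row_weak r c (c + 1) (Nat.lt_succ_self c) h1
      rwa [Function.update_self, Function.update_of_ne (by simp)] at this
    · have := h.col_strict r (r + 1) c (Nat.lt_succ_self r) h1
      rwa [Function.update_self, Function.update_of_ne (by simp)] at this
  · rintro ⟨h1, h2⟩
    refine ⟨fun r' c₁ c₂ hc hm => ?_, fun r₁ r₂ c' hr hm => ?_, fun s hs => ?_⟩
    · by_cases e2 : (r', c₂) = (r, c)
      · obtain ⟨rfl, rfl⟩ := Prod.ext_iff.1 e2
        rw [Function.update_self, Function.update_of_ne (by simpa using hc.ne)]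
        exact hk.le.trans (hT.row_weak _ _ _ hc hm)
      · rw [Function.update_of_ne e2]
        by_cases e1 : (r', c₁) = (r, c)
        · obtain ⟨rfl, rfl⟩ := Prod.ext_iff.1 e1
          rw [Function.update_self]
          refine le_trans ?_ (h1 (μ.up_left_mem le_rfl (Nat.succ_le_of_lt hc) hm))
          rcases (Nat.succ_le_of_lt hc).eq_or_lt with h | h
          · exact le_of_eq (by rw [← h])
          · exact hT.row_weak _ _ _ h hm
        · rw [Function.update_of_ne e1]
          exact hT.row_weak _ _ _ hc hm
    · by_cases e2 : (r₂, c') = (r, c)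
      · obtain ⟨rfl, rfl⟩ := Prod.ext_iff.1 e2
        rw [Function.update_self, Function.update_of_ne (by simpa using hr.ne)]
        exact hk.trans (hT.col_strict _ _ _ hr hm)
      · rw [Function.update_of_ne e2]
        by_cases e1 : (r₁, c') = (r, c)
        · obtain ⟨rfl, rfl⟩ := Prod.ext_iff.1 e1
          rw [Function.update_self]
          refine lt_of_le_of_lt ?_ (h2 (μ.up_left_mem (Nat.succ_le_of_lt hr) le_rfl hm))
          rcases (Nat.succ_le_of_lt hr).eq_or_lt with h | h
          · exact le_of_eq (by rw [← h])
          · exact (hT.col_strict _ _ _ h hm).le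
        · rw [Function.update_of_ne e1]
          exact hT.col_strict _ _ _ hr hm
    · rw [Function.update_of_ne (by rintro rfl; exact hs hrc)]
      exact hT.zeros s hs

/-- A value k missing from the column can only replace the lowest entry exceeding k, in row `cnt (k
+ 1) - 1`; the right neighbour gives the remaining condition. -/
theorem replace_iff {r c k : ℕ} (hr : r < μ.colLen c) :
    (k < T (r, c) ∧ IsRSSYT μ (Function.update T (r, c) k)) ↔
      (k ∉ column μ T c ∧
        cnt (k + 1) (column μ T (c + 1)) < cnt (k + 1) (column μ T c)) ∧
      cnt (k + 1) (column μ T c) = r + 1 := by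
  have hk : k < T (r, c) ↔ r < cnt (k + 1) (column μ T c) := le_iff_lt_cnt_column hT hr (k + 1)
  have hright : ((r, c + 1) ∈ μ → T (r, c + 1) ≤ k) ↔ cnt (k + 1) (column μ T (c + 1)) ≤ r := by
    by_cases h : r < μ.colLen (c + 1)
    · rw [← not_lt (a := r), ← le_iff_lt_cnt_column hT h]
      simp [YoungDiagram.mem_iff_lt_colLen, h]
    · refine iff_of_true (fun h' => absurd (YoungDiagram.mem_iff_lt_colLen.1 h') h) ?_
      exact (cnt_le_card _ _).trans ((card_column hT _).le.trans (not_lt.1 h))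
  have hbelow : ((r + 1, c) ∈ μ → T (r + 1, c) < k) ↔ cnt k (column μ T c) ≤ r + 1 := by
    by_cases h : r + 1 < μ.colLen c
    · rw [← not_lt (a := r + 1), ← le_iff_lt_cnt_column hT h]
      simp [YoungDiagram.mem_iff_lt_colLen, h]
    · refine iff_of_true (fun h' => absurd (YoungDiagram.mem_iff_lt_colLen.1 h') h) ?_
      exact (cnt_le_card _ _).trans ((card_column hT _).le.trans (not_lt.1 h))
  have e : (k < T (r, c) ∧ IsRSSYT μ (Function.update T (r, c) k)) ↔
      (k < T (r, c) ∧ ((r, c + 1) ∈ μ → T (r, c + 1) ≤ k) ∧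
        ((r + 1, c) ∈ μ → T (r + 1, c) < k)) :=
    and_congr_right fun h => isRSSYT_update_iff hT (YoungDiagram.mem_iff_lt_colLen.2 hr) h
  rw [e, hk, hright, hbelow, cnt_eq k]
  by_cases hkC : k ∈ column μ T c
  · simp only [hkC, if_true, not_true_eq_false, false_and, iff_false]
    omega
  · simp only [hkC, if_false, not_false_eq_true, true_and]
    omega

open Classical in
theorem prod_replace_eq {c N : ℕ} (hN : column μ T c ⊆ Finset.range N) (f : ℕ → LRing) :
    (∏ r ∈ Finset.range (μ.colLen c), ∏ k ∈ (Finset.range (T (r, c))).filter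
      (fun k => IsRSSYT μ (Function.update T (r, c) k)), f k) =
    ∏ k ∈ (Finset.range N).filter (fun k => k ∉ column μ T c ∧
      cnt (k + 1) (column μ T (c + 1)) < cnt (k + 1) (column μ T c)), f k := by
  have h : ∀ r ∈ Finset.range (μ.colLen c), (∏ k ∈ (Finset.range (T (r, c))).filter
      (fun k => IsRSSYT μ (Function.update T (r, c) k)), f k) =
      ∏ k ∈ (Finset.range N).filter (fun k => k ∉ column μ T c ∧
        cnt (k + 1) (column μ T (c + 1)) < cnt (k + 1) (column μ T c)),
        if cnt (k + 1) (column μ T c) = r + 1 then f k else 1 := by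
    intro r hr
    rw [← Finset.prod_filter, Finset.filter_filter]
    refine Finset.prod_congr ?_ fun _ _ => rfl
    ext k
    rw [Finset.mem_filter, Finset.mem_filter, Finset.mem_range, Finset.mem_range,
      ← replace_iff hT (Finset.mem_range.1 hr)]
    refine ⟨fun h => ⟨h.1.trans ?_, h⟩, fun h => h.2⟩
    exact Finset.mem_range.1 (hN (Finset.mem_image_of_mem _ hr))
  rw [Finset.prod_congr rfl h, Finset.prod_comm]
  refine Finset.prod_congr rfl fun k hk => ?_
  have hk := (Finset.mem_filter.1 hk).2.2
  have hle := (cnt_le_card (k + 1) (column μ T c)).trans (card_column hT c).le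
  -- Each admissible k belongs to exactly one row of the column.
  rw [Finset.prod_eq_single (cnt (k + 1) (column μ T c) - 1)]
  · rw [if_pos (by omega)]
  · intro r _ hne
    rw [if_neg (by omega)]
  · intro hnot
    rw [Finset.mem_range] at hnot
    omega

theorem weight_eq_prod_colWeight {N : ℕ} (hN : ∀ c, column μ T c ⊆ Finset.range N) :
    xpow (wt μ T) * replaceProd μ T =
      ∏ c ∈ Finset.range (μ.rowLen 0), colWeight N (column μ T c) (column μ T (c + 1)) := by
  have hmem : ∀ p : ℕ × ℕ, p ∈ μ.cells ↔
      p.2 ∈ Finset.range (μ.rowLen 0) ∧ p.1 ∈ Finset.range (μ.colLen p.2) := by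
    rintro ⟨r, c⟩
    rw [YoungDiagram.mem_cells, Finset.mem_range, Finset.mem_range,
      ← YoungDiagram.mem_iff_lt_colLen]
    exact ⟨fun h => ⟨lt_rowLen_zero_of_mem h, h⟩, fun h => h.2⟩
  have hx : xpow (wt μ T) = ∏ s ∈ μ.cells, (X (T s) : LRing) := by
    rw [xpow, wt, monomial_sum_one]
    rfl
  rw [hx, replaceProd, Finset.prod_finset_product_right _ _ (fun c => Finset.range (μ.colLen c)) hmem,
    Finset.prod_finset_product_right _ _ (fun c => Finset.range (μ.colLen c)) hmem, ← Finset.prod_mul_distrib]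
  refine Finset.prod_congr rfl fun c _ => ?_
  rw [prod_replace_eq hT (hN c), colWeight]
  congr 1
  rw [column, Finset.prod_image]
  intro a ha b hb hab
  simp only [Finset.coe_range, Set.mem_Iio] at ha hb
  have h1 := (le_iff_lt_cnt_column hT ha (T (b, c))).1 hab.ge
  rcases lt_trichotomy a b with h | h | h
  · exact absurd hab (hT.col_strict a b c h (YoungDiagram.mem_iff_lt_colLen.2 hb)).ne'
  · exact h
  · exact absurd hab (hT.col_strict b a c h (YoungDiagram.mem_iff_lt_colLen.2 ha)).ne

end Tableau

/-! ### Bijection between tableaux and lists of columns. -/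

theorem headD_map_range {m : ℕ} {col : ℕ → Finset ℕ} (h : col m = ∅) :
    ((List.range m).map col).headD ∅ = col 0 := by
  cases m with
  | zero => simpa using h.symm
  | succ m => simp [List.range_succ_eq_map]

theorem map_range_mem_tableauLists_iff {N m : ℕ} {col : ℕ → Finset ℕ} {len : ℕ → ℕ}
    (h : col m = ∅) :
    (List.range m).map col ∈ tableauLists N ((List.range m).map len) ↔
      ∀ c < m, col c ⊆ Finset.range N ∧ (col c).card = len c ∧ Dominates (col c) (col (c + 1)) := by
  induction m generalizing col len with
  | zero => simp [tableauLists]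
  | succ m ih =>
    rw [List.range_succ_eq_map, List.map_cons, List.map_cons, List.map_map, List.map_map,
      cons_mem_tableauLists, ih (col := col ∘ Nat.succ) h, headD_map_range (col := col ∘ Nat.succ) h]
    constructor
    · rintro ⟨h1, h2, h3, h4⟩ c hc
      cases c with
      | zero => exact ⟨h1, h2, h3⟩
      | succ c => exact h4 c (by omega)
    · intro h'
      obtain ⟨h1, h2, h3⟩ := h' 0 (by omega)
      exact ⟨h1, h2, h3, fun c hc => h' (c + 1) (by omega)⟩

theorem length_of_mem_tableauLists {N : ℕ} {hs : List ℕ} {L : List (Finset ℕ)}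
    (h : L ∈ tableauLists N hs) : L.length = hs.length := by
  induction hs generalizing L with
  | nil => simpa [tableauLists] using h
  | cons n hs ih =>
    obtain ⟨C, L, rfl⟩ := exists_of_mem_tableauLists_cons h
    simp [ih (cons_mem_tableauLists.1 h).2.2.2]

theorem listWeight_map_range {N m : ℕ} {col : ℕ → Finset ℕ} (h : col m = ∅) :
    listWeight N ((List.range m).map col) =
      ∏ c ∈ Finset.range m, colWeight N (col c) (col (c + 1)) := by
  induction m generalizing col with
  | zero => simp [listWeight]
  | succ m ih =>
    rw [List.range_succ_eq_map, List.map_cons, List.map_map, listWeight,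
      ih (col := col ∘ Nat.succ) h, headD_map_range (col := col ∘ Nat.succ) h,
      Finset.prod_range_succ', mul_comm]
    rfl

theorem keyList_map_range (m : ℕ) (col : ℕ → Finset ℕ) :
    keyList ((List.range m).map col) =
      (List.range m).map fun c => (List.range c).foldr (fun j D => tri (col j) D) (col c) := by
  induction m generalizing col with
  | zero => rfl
  | succ m ih =>
    rw [List.range_succ_eq_map, List.map_cons, List.map_map, keyList, keyCons, ih, List.map_cons,
      List.map_map, List.map_map]
    congr 1
    refine List.map_congr_left fun c _ => ?_
    simp only [Function.comp_apply, List.range_succ_eq_map (n := c), List.foldr_cons,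
      List.foldr_map]

/-- The list of columns of a tableau. -/
def columnList (μ : YoungDiagram) (T : ℕ × ℕ → ℕ) : List (Finset ℕ) :=
  (List.range (μ.rowLen 0)).map (column μ T)

/-- The list of column lengths of a diagram. -/
def colLens (μ : YoungDiagram) : List ℕ := (List.range (μ.rowLen 0)).map μ.colLen

theorem keyContent_keyList_columnList (μ : YoungDiagram) (T : ℕ × ℕ → ℕ) :
    keyContent (keyList (columnList μ T)) = leftKey μ T := by
  rw [columnList, keyList_map_range, keyContent, List.map_map, leftKey, Finset.sum_range]
  rw [← List.sum_ofFn, List.ofFn_eq_map, ← List.map_coe_finRange_eq_range, List.map_map]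
  rfl

/-- The first column belongs to the left key and dominates all other columns. -/
theorem column_subset_range {μ : YoungDiagram} {T : ℕ × ℕ → ℕ} (hT : IsRSSYT μ T) {N : ℕ}
    (h : (leftKey μ T).support ⊆ Finset.range N) (c : ℕ) : column μ T c ⊆ Finset.range N := by
  have h0 : column μ T 0 ⊆ Finset.range N := by
    intro a ha
    refine h ?_
    have hpos : 0 < μ.rowLen 0 := by
      by_contra h'
      rw [column_eq_empty (by omega)] at ha
      exact Finset.notMem_empty a ha
    rw [Finsupp.mem_support_iff, ← keyContent_keyList_columnList, columnList, keyList_map_range,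
      keyContent_apply, ← Nat.succ_pred_eq_of_pos hpos, List.range_succ_eq_map]
    simp [ha]
  rcases Nat.eq_zero_or_pos c with rfl | hc
  · exact h0
  · exact subset_range_of_dominates (dominates_column hT hc) h0

theorem columnList_bijOn (μ : YoungDiagram) {α : Comp} {N : ℕ}
    (hα : α.support ⊆ Finset.range N) :
    Set.BijOn (columnList μ) {T | IsRSSYT μ T ∧ BruhatLE (leftKey μ T) α}
      {L | L ∈ tableauLists N (colLens μ) ∧ BruhatLE (keyContent (keyList L)) α} := by
  refine ⟨?_, ?_, ?_⟩
  · rintro T ⟨hT, hle⟩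
    refine ⟨?_, by rwa [keyContent_keyList_columnList]⟩
    rw [columnList, colLens, map_range_mem_tableauLists_iff (column_eq_empty le_rfl T)]
    exact fun c _ => ⟨column_subset_range hT (support_subset_of_le hle hα) c, card_column hT c,
      dominates_column hT (Nat.lt_succ_self c)⟩
  · rintro T ⟨hT, -⟩ T' ⟨hT', -⟩ h
    have hcol : ∀ c < μ.rowLen 0, column μ T c = column μ T' c := fun c hc =>
      List.map_inj_left.1 h c (List.mem_range.2 hc)
    funext ⟨r, c⟩
    by_cases hm : (r, c) ∈ μ
    · have hr := YoungDiagram.mem_iff_lt_colLen.1 hm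
      refine eq_of_forall_le_iff fun t => ?_
      rw [le_iff_lt_cnt_column hT hr, le_iff_lt_cnt_column hT' hr,
        hcol c (lt_rowLen_zero_of_mem hm)]
    · rw [hT.zeros _ hm, hT'.zeros _ hm]
  · rintro L ⟨hL, hle⟩
    have hlen : L.length = μ.rowLen 0 := by
      rw [length_of_mem_tableauLists hL, colLens, List.length_map, List.length_range]
    have hLcol : L = (List.range (μ.rowLen 0)).map fun c => L.getD c ∅ := by
      refine List.ext_getElem (by simp [hlen]) fun n h1 _ => ?_
      rw [List.getElem_map, List.getElem_range, List.getD_eq_getElem _ _ h1]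
    have hempty : ∀ c, μ.rowLen 0 ≤ c → L.getD c ∅ = ∅ := fun c hc =>
      List.getD_eq_default _ _ (by omega)
    have htab := hL
    rw [hLcol, colLens, map_range_mem_tableauLists_iff (hempty _ le_rfl)] at htab
    choose f hf hf' using exists_strictAnti_image
    have hcard : ∀ c, (L.getD c ∅).card = μ.colLen c := by
      intro c
      rcases lt_or_ge c (μ.rowLen 0) with hc | hc
      · exact (htab c hc).2.1
      · rw [hempty c hc, colLen_eq_zero hc, Finset.card_empty]
    have hdom : ∀ c c', c ≤ c' → Dominates (L.getD c ∅) (L.getD c' ∅) := by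
      intro c c' hcc'
      induction c', hcc' using Nat.le_induction with
      | base => exact fun t => le_rfl
      | succ c' _ ih =>
        intro t
        refine le_trans ?_ (ih t)
        rcases lt_or_ge c' (μ.rowLen 0) with hc | hc
        · exact (htab c' hc).2.2 t
        · rw [hempty (c' + 1) (by omega)]
          simp [cnt]
    classical
    -- The inverse lists each column in decreasing order; the value 0 outside μ is forced by
    -- `zeros`.
    let T : ℕ × ℕ → ℕ := fun s => if s ∈ μ then f (L.getD s.2 ∅) s.1 else 0
    have hTval : ∀ r c, (r, c) ∈ μ → T (r, c) = f (L.getD c ∅) r := fun r c h => if_pos h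
    have hcolumn : ∀ c, column μ T c = L.getD c ∅ := by
      intro c
      refine Eq.trans ?_ (hf' (L.getD c ∅))
      rw [column, hcard]
      refine Finset.image_congr fun r hr => hTval r c ?_
      exact YoungDiagram.mem_iff_lt_colLen.2 (by simpa using hr)
    have hT : IsRSSYT μ T := by
      refine ⟨fun r c₁ c₂ hc hm => ?_, fun r₁ r₂ c hr hm => ?_, fun s hs => if_neg hs⟩
      · have hm1 := μ.up_left_mem le_rfl hc.le hm
        have h1 := YoungDiagram.mem_iff_lt_colLen.1 hm1
        have h2 := YoungDiagram.mem_iff_lt_colLen.1 hm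
        rw [← hcard] at h1 h2
        rw [hTval _ _ hm, hTval _ _ hm1, le_iff_lt_cnt_image (hf _) h1, hf']
        refine lt_of_lt_of_le ?_ (hdom c₁ c₂ hc.le _)
        have h3 := (le_iff_lt_cnt_image (hf _) h2 (f (L.getD c₂ ∅) r)).1 le_rfl
        rwa [hf'] at h3
      · rw [hTval _ _ hm, hTval _ _ (μ.up_left_mem hr.le le_rfl hm)]
        refine hf _ _ _ hr ?_
        rw [hcard]
        exact YoungDiagram.mem_iff_lt_colLen.1 hm
    have hTL : columnList μ T = L := by
      refine Eq.trans ?_ hLcol.symm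
      exact List.map_congr_left fun c _ => hcolumn c
    refine ⟨T, ⟨hT, ?_⟩, hTL⟩
    rwa [← keyContent_keyList_columnList, hTL]

/-! ### Shapes of compositions and the final induction. -/

theorem shape_swapComp (i j : ℕ) (α : Comp) : shape (swapComp i j α) = shape α := by
  have h : (swapComp i j α).support.val.map (swapComp i j α) = α.support.val.map α := by
    have hs : (swapComp i j α).support = α.support.map (Equiv.swap i j).toEmbedding := by
      ext k
      rw [Finset.mem_map_equiv, Equiv.symm_swap, Finsupp.mem_support_iff, Finsupp.mem_support_iff,
        swapComp_apply]
    rw [hs, Finset.map_val, Multiset.map_map]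
    refine Multiset.map_congr rfl fun k _ => ?_
    simp [swapComp_apply]
  simp only [shape, h]

theorem support_eq_range_of_antitone {α : Comp} (hα : Antitone α) :
    α.support = Finset.range α.support.card := by
  refine (Finset.eq_of_subset_of_card_le (fun k hk => ?_) (by rw [Finset.card_range])).symm
  by_contra hk'
  have hsub : α.support ⊆ Finset.range k := fun j hj => by
    rw [Finset.mem_range]
    by_contra hjk
    have := hα (not_lt.1 hjk)
    rw [Finsupp.mem_support_iff] at hj
    rw [Finsupp.notMem_support_iff] at hk'
    omega
  have := Finset.card_le_card hsub
  rw [Finset.card_range] at this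
  have := Finset.mem_range.1 hk
  omega

theorem rowLen_shape {α : Comp} (hα : Antitone α) (r : ℕ) : (shape α).rowLen r = α r := by
  have hw : (α.support.val.map α).sort (· ≥ ·) = (List.range α.support.card).map α := by
    have hm : α.support.val.map α = ((List.range α.support.card).map α : List ℕ) := by
      conv_lhs => rw [support_eq_range_of_antitone hα]
      rfl
    rw [hm, Multiset.coe_sort, List.mergeSort_eq_self]
    rw [List.pairwise_map]
    exact List.pairwise_lt_range.imp fun h => hα h.le
  refine eq_of_forall_lt_iff fun c => ?_
  rw [← YoungDiagram.mem_iff_lt_rowLen, shape, YoungDiagram.mem_ofRowLens]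
  simp only [hw, List.length_map, List.length_range, List.getElem_map, List.getElem_range]
  refine ⟨fun ⟨_, h⟩ => h, fun h => ⟨?_, h⟩⟩
  rw [← Finset.mem_range, ← support_eq_range_of_antitone hα, Finsupp.mem_support_iff]
  omega

theorem keyContent_colLens (μ : YoungDiagram) (r : ℕ) :
    keyContent ((colLens μ).map Finset.range) r = μ.rowLen r := by
  rw [keyContent_apply, colLens, List.map_map, List.map_map]
  have : ((List.range (μ.rowLen 0)).map
      (((fun D : Finset ℕ => if r ∈ D then 1 else 0) ∘ Finset.range) ∘ μ.colLen)).sum =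
      ∑ c ∈ Finset.range (μ.rowLen 0), if c < μ.rowLen r then 1 else 0 := by
    rw [Finset.sum_range, ← List.sum_ofFn, List.ofFn_eq_map, ← List.map_coe_finRange_eq_range,
      List.map_map]
    congr 1
    refine List.map_congr_left fun c _ => ?_
    simp only [Function.comp_apply, Finset.mem_range, ← YoungDiagram.mem_iff_lt_colLen,
      YoungDiagram.mem_iff_lt_rowLen]
  rw [this, ← Finset.card_filter]
  have : (Finset.range (μ.rowLen 0)).filter (· < μ.rowLen r) = Finset.range (μ.rowLen r) := by
    ext c
    have := μ.rowLen_anti 0 r (Nat.zero_le r)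
    simp only [Finset.mem_filter, Finset.mem_range]
    omega
  rw [this, Finset.card_range]

theorem colLens_pairwise (μ : YoungDiagram) : (colLens μ).Pairwise (· ≥ ·) := by
  rw [colLens, List.pairwise_map]
  exact List.pairwise_lt_range.imp fun h => μ.colLen_anti _ _ h.le

/-- The sum of the coefficients of all keys below `α`, over the tableaux of shape `μ` with entries
smaller than `N`. -/
def belowSum (N : ℕ) (μ : YoungDiagram) (α : Comp) : LRing :=
  evalBelow α (∑ C ∈ (Finset.range N).powerset, colSum N (colLens μ) C)

open Classical in
-- A partition is minimal in Bruhat order, so only the tableau with all entries of row r equal to r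
-- contributes, and it admits no replacement.
theorem belowSum_of_antitone {N : ℕ} {α : Comp} (hα : Antitone α)
    (hN : α.support ⊆ Finset.range N) : belowSum N (shape α) α = xpow α := by
  have hcontent : keyContent ((colLens (shape α)).map Finset.range) = α := by
    ext r
    rw [keyContent_colLens, rowLen_shape hα]
  have hle : ∀ k ∈ colLens (shape α), k ≤ N := by
    intro k hk
    obtain ⟨c, -, rfl⟩ := List.mem_map.1 hk
    by_contra h
    have h1 := YoungDiagram.mem_iff_lt_rowLen.1 (YoungDiagram.mem_iff_lt_colLen.2 (not_le.1 h))
    rw [rowLen_shape hα] at h1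
    have := Finset.mem_range.1 (hN (Finsupp.mem_support_iff.2 (show α N ≠ 0 by omega)))
    omega
  obtain ⟨h1, h2, h3⟩ := map_range_mem_tableauLists (colLens_pairwise (shape α)) hle
  rw [belowSum, evalBelow_sum_colSum, Finset.sum_eq_single_of_mem
    ((colLens (shape α)).map Finset.range), h3, hcontent]
  · rw [Finset.mem_filter, h2, hcontent]
    exact ⟨h1, Relation.ReflTransGen.refl⟩
  · intro L hL hne
    obtain ⟨hL, hle⟩ := Finset.mem_filter.1 hL
    refine absurd (eq_map_range_of_keyContent (colLens_pairwise _) hL ?_) hne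
    rw [eq_of_le_antitone hα hle, hcontent]

theorem lascoux_eq_belowSum {N : ℕ} (α : Comp) (hN : α.support ⊆ Finset.range N) :
    lascoux α = belowSum N (shape α) α := by
  induction hn : momentum α using Nat.strong_induction_on generalizing α with
  | _ n ih =>
    subst hn
    by_cases hα : Antitone α
    · rw [lascoux_of_partition α hα, belowSum_of_antitone hα hN]
    · have hex : ∃ i, α i < α (i + 1) := by
        by_contra h
        push Not at h
        exact hα (antitone_nat_of_succ_le h)
      obtain ⟨i, hi⟩ := hex
      -- The part at i + 1 is positive, being larger than the one at i; thus s_i preserves the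
      -- alphabet `range N`, and one N serves the whole induction.
      have hiN : i + 1 < N :=
        Finset.mem_range.1 (hN (Finsupp.mem_support_iff.2 (by omega)))
      rw [lascoux_of_ascent α i hi, ih _ (momentum_swapComp_lt i α hi) _
        (support_swapComp_subset hiN hN) rfl, shape_swapComp]
      exact piBeta_evalBelow hi (sum_colSum_mem hiN _)

end

/-- The set of tableaux is finite, so that the sum is a genuine finite sum. -/
theorem theorem1p2 (α : Comp) :
    (tableauxBelow α).Finite ∧
      lascoux α = ∑ᶠ T ∈ tableauxBelow α, xpow (wt (shape α) T) * replaceProd (shape α) T := by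
  classical
  obtain ⟨N, hN⟩ := Finset.exists_nat_subset_range α.support
  have hbij := columnList_bijOn (shape α) hN
  have hset : {L | L ∈ tableauLists N (colLens (shape α)) ∧ BruhatLE (keyContent (keyList L)) α} =
      ↑((tableauLists N (colLens (shape α))).filter
        fun L => BruhatLE (keyContent (keyList L)) α) := by
    ext L
    simp
  refine ⟨hbij.finite_iff_finite.2 (hset ▸ Finset.finite_toSet _), ?_⟩
  rw [lascoux_eq_belowSum α hN, belowSum, evalBelow_sum_colSum,
    ← finsum_mem_coe_finset, ← hset]
  refine (finsum_mem_eq_of_bijOn _ hbij fun T hT => ?_).symm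
  rw [weight_eq_prod_colWeight hT.1 (column_subset_range hT.1 (support_subset_of_le hT.2 hN)),
    columnList, listWeight_map_range (column_eq_empty le_rfl T)]
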